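/- Let $n,d\ge 1$ and $B>0$, and let $X=(X_1,\dots,X_n)$ be independent samples from $N(0,\Sigma)$ on $\mathbb{R}^d$, where the unknown $\Sigma$ lies in the set $\Xi$ of symmetric positive definite $d\times d$ matrices with spectral norm $\|\Sigma\|_2\le B$. A deterministic estimator is a measurable map $\hat\Sigma:(\mathbb{R}^d)^n\to\Xi$; a randomized estimator is a random deterministic estimator drawn independently of the data (jointly measurably in the draw and the data). The loss is the entropy loss $$M(\Sigma_1,\Sigma_2)=\operatorname{tr}(\Sigma_1^{-1}\Sigma_2)-\log|\Sigma_1^{-1}\Sigma_2|-d\ \ge 0,$$ the risk is $R(\hat\Sigma,\Sigma)=\mathbb{E}[M(\hat\Sigma(X),\Sigma)]\in[0,\infty]$ (expectation over the data and the draw), and the minimax risk $R^*=\inf_{\hat\Sigma}\sup_{\Sigma\in\Xi}R(\hat\Sigma,\Sigma)$ is the infimum over all randomized estimators. Let $S_n=\frac1n\sum_{i=1}^nX_iX_i^T=U\Delta U^T$ be the eigendecomposition of the empirical covariance matrix, with $\Delta_i$ the $i$-th diagonal entry of $\Delta$. For Borel functions $f:\mathbb{R}\times\mathbb{R}^d\to\mathbb{R}$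 and $g:\mathbb{R}^2\to\mathbb{R}^d$ put $$\hat\Sigma_{f,g}(X)=U\,\mathrm{Diag}\Big(f\big(\Delta_i,\textstyle\sum_{j\ne i}g(\Delta_i,\Delta_j)\big)\Big)_{i=1}^d\,U^T ,$$ which does not depend on the choice of the eigendecomposition. Let $\mathcal{D}_{f,g}$ be the set of deterministic estimators of this form and $\mathcal{M}_{f,g}$ the set of randomized estimators supported on $\mathcal{D}_{f,g}$; let $\mathcal{M}_{\mathcal{D},G}$ be the set of randomized estimators supported on the deterministic estimators that satisfy $\hat\Sigma(VX_1,\dots,VX_n)=V\hat\Sigma(X_1,\dots,X_n)V^T$ for every orthogonal matrix $V$ and all data. Then: (i) There is a deterministic estimator $\hat\Sigma^*$ that is minimax, i.e. $\sup_{\Sigma\in\Xi}R(\hat\Sigma^*,\Sigma)=R^*$, and that can be approximated arbitrarily well by estimators in $\mathcal{D}_{f,g}$: for every $\varepsilon>0$ there is $\hat\Sigma_{f,g}\in\mathcal{D}_{f,g}$ with $\|\hat\Sigma_{f,g}(X)-\hat\Sigma^*(X)\|_2\le\varepsilon$ for all data $X$ and, for all $\Sigma\in\Xi$, $R(\hat\Sigma_{f,g},\Sigma)\le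 R(\hat\Sigma^*,\Sigma)+\varepsilon$ and $R(\hat\Sigma^*,\Sigma)\le R(\hat\Sigma_{f,g},\Sigma)+\varepsilon$. (ii) With $\Xi_G=\{\lambda\in\mathbb{R}^d: B\ge\lambda_1\ge\dots\ge\lambda_d>0\}$, $$\inf_{\hat\Sigma\in\mathcal{M}_{\mathcal{D},G}}\ \sup_{\lambda\in\Xi_G}R(\hat\Sigma,\mathrm{Diag}(\lambda))=\inf_{\hat\Sigma\in\mathcal{M}_{f,g}}\ \sup_{\lambda\in\Xi_G}R(\hat\Sigma,\mathrm{Diag}(\lambda))=R^*.$$ -/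

import Mathlib

open MeasureTheory ProbabilityTheory
open scoped ENNReal Matrix

noncomputable section

namespace CovarianceGame

/-- The data: `n` observations in `ℝ^d`. -/
abbrev Sample (n d : ℕ) : Type := Fin n → EuclideanSpace ℝ (Fin d)

/-- The spectral (ℓ² operator) norm of a real square matrix. -/
def opNorm {d : ℕ} (A : Matrix (Fin d) (Fin d) ℝ) : ℝ :=
  ‖Matrix.toEuclideanCLM (n := Fin d) (𝕜 := ℝ) A‖

/-- The parameter space: symmetric positive definite matrices of spectral norm at most `B`. -/
def paramSpace (d : ℕ) (B : ℝ) : Set (Matrix (Fin d) (Fin d) ℝ) :=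
  {S | S.PosDef ∧ opNorm S ≤ B}

/-- The reduced parameter space: vectors `λ` with `B ≥ λ₁ ≥ ⋯ ≥ λ_d > 0`. -/
def spectrumSpace (d : ℕ) (B : ℝ) : Set (Fin d → ℝ) :=
  {l | Antitone l ∧ ∀ i, 0 < l i ∧ l i ≤ B}

/-- The law of `n` independent samples from `N(0, S)`. -/
def sampleLaw (n : ℕ) {d : ℕ} (S : Matrix (Fin d) (Fin d) ℝ) : Measure (Sample n d) :=
  Measure.pi fun _ => multivariateGaussian 0 S

/-- The entropy loss `M(A, S) = tr(A⁻¹ S) - log |A⁻¹ S| - d` of the estimate `A` when the true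
covariance matrix is `S`. -/
def entropyLoss {d : ℕ} (A S : Matrix (Fin d) (Fin d) ℝ) : ℝ :=
  (A⁻¹ * S).trace - Real.log (A⁻¹ * S).det - d

/-- The empirical covariance matrix `S_n = (1/n) ∑ Xᵢ Xᵢᵀ`. -/
def empiricalCov {n d : ℕ} (X : Sample n d) : Matrix (Fin d) (Fin d) ℝ :=
  (n : ℝ)⁻¹ • ∑ k, Matrix.vecMulVec (X k).ofLp (X k).ofLp

/-- The action `X ↦ (g X₁, …, g X_n)` of a matrix on the data. -/
def actSample {n d : ℕ} (g : Matrix (Fin d) (Fin d) ℝ) (X : Sample n d) : Sample n d :=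
  fun k => WithLp.toLp 2 (g *ᵥ (X k).ofLp)

/-- A deterministic estimator: a measurable map from the data to the parameter space. -/
structure Estimator (n d : ℕ) (B : ℝ) where
  /-- the estimate computed from the data -/
  est : Sample n d → Matrix (Fin d) (Fin d) ℝ
  measurable_est : ∀ i j, Measurable fun X => est X i j
  est_mem : ∀ X, est X ∈ paramSpace d B

/-- The risk `R(Σ̂, S) = 𝔼[M(Σ̂(X), S)]`. The entropy loss of positive definite matrices is
nonnegative, so that the expectation always exists in `[0, ∞]`. -/
def Estimator.risk {n d : ℕ} {B : ℝ} (δ : Estimator n d B) (S : Matrix (Fin d) (Fin d) ℝ) :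
    ℝ≥0∞ :=
  ∫⁻ X, ENNReal.ofReal (entropyLoss (δ.est X) S) ∂(sampleLaw n S)

/-- A randomized estimator supported on a class `C` of deterministic estimators: a deterministic
estimator in `C` is drawn by means of a random seed `ω`, independent of the data, jointly
measurably in the seed and the data. (In general there is no σ-algebra on the set of all measurable maps for
which evaluation is jointly measurable, so that a probability measure on this set has to be
presented through such a random element.) -/
structure RandomizedEstimator {n d : ℕ} {B : ℝ} (C : Set (Estimator n d B)) where
  /-- the space of seeds -/
  Seed : Type
  [seedMeasurableSpace : MeasurableSpace Seed]
  /-- the law of the seed -/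
  law : Measure Seed
  [isProbabilityMeasure_law : IsProbabilityMeasure law]
  /-- the deterministic estimator that is used when the seed is drawn -/
  draw : Seed → Estimator n d B
  draw_mem : ∀ ω, draw ω ∈ C
  measurable_draw : ∀ i j, Measurable fun p : Seed × Sample n d => (draw p.1).est p.2 i j

attribute [instance] RandomizedEstimator.seedMeasurableSpace
  RandomizedEstimator.isProbabilityMeasure_law

/-- The risk of a randomized estimator: the expectation is over the data and the seed. -/
def RandomizedEstimator.risk {n d : ℕ} {B : ℝ} {C : Set (Estimator n d B)}
    (T : RandomizedEstimator C) (S : Matrix (Fin d) (Fin d) ℝ) : ℝ≥0∞ :=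
  ∫⁻ ω, (T.draw ω).risk S ∂T.law

/-- The minimax risk `R*`: the infimum over all randomized estimators of the worst-case risk. -/
def minimaxRisk (n d : ℕ) (B : ℝ) : ℝ≥0∞ :=
  ⨅ T : RandomizedEstimator (Set.univ : Set (Estimator n d B)), ⨆ S ∈ paramSpace d B, T.risk S

/-- The value of the reduced game, in which the statistician randomizes over a class `C` of
deterministic estimators and nature chooses `Diag(λ)` with `B ≥ λ₁ ≥ ⋯ ≥ λ_d > 0`. -/
def reducedValue {n d : ℕ} {B : ℝ} (C : Set (Estimator n d B)) : ℝ≥0∞ :=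
  ⨅ T : RandomizedEstimator C, ⨆ l ∈ spectrumSpace d B, T.risk (Matrix.diagonal l)

/-- A deterministic estimator is minimax if its worst-case risk is the minimax risk `R*`. -/
def Estimator.IsMinimax {n d : ℕ} {B : ℝ} (δ : Estimator n d B) : Prop :=
  (⨆ S ∈ paramSpace d B, δ.risk S) = minimaxRisk n d B

/-- The deterministic estimators that are invariant under the orthogonal group:
`Σ̂(g X) = g Σ̂(X) gᵀ`. -/
def invariantEstimators (n d : ℕ) (B : ℝ) : Set (Estimator n d B) :=
  {δ | ∀ g ∈ Matrix.orthogonalGroup (Fin d) ℝ, ∀ X, δ.est (actSample g X) = g * δ.est X * gᵀ}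

/-- The `i`-th diagonal entry `f(Δᵢ, ∑_{j ≠ i} g(Δᵢ, Δⱼ))`. -/
def spectralEntry {d : ℕ} (f : ℝ → (Fin d → ℝ) → ℝ) (g : ℝ → ℝ → (Fin d → ℝ)) (D : Fin d → ℝ)
    (i : Fin d) : ℝ :=
  f (D i) (∑ j ∈ Finset.univ.erase i, g (D i) (D j))

/-- The deterministic estimator `δ` is `Σ̂_{f,g}`: whenever `U Diag(Δ) Uᵀ` is an
eigendecomposition of `S_n`, the estimate is `U Diag(f(Δᵢ, ∑_{j ≠ i} g(Δᵢ, Δⱼ))) Uᵀ`. Every `S_n`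
has an eigendecomposition, and the value does not depend on its choice. -/
def Estimator.IsSpectral {n d : ℕ} {B : ℝ} (δ : Estimator n d B)
    (f : ℝ → (Fin d → ℝ) → ℝ) (g : ℝ → ℝ → (Fin d → ℝ)) : Prop :=
  ∀ X : Sample n d, ∀ U ∈ Matrix.orthogonalGroup (Fin d) ℝ, ∀ D : Fin d → ℝ,
    empiricalCov X = U * Matrix.diagonal D * Uᵀ →
      δ.est X = U * Matrix.diagonal (spectralEntry f g D) * Uᵀ

/-- The deterministic estimators of the form `Σ̂_{f,g}` with Borel functions
`f : ℝ × ℝ^d → ℝ` and `g : ℝ × ℝ → ℝ^d`. -/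
def spectralEstimators (n d : ℕ) (B : ℝ) : Set (Estimator n d B) :=
  {δ | ∃ (f : ℝ → (Fin d → ℝ) → ℝ) (g : ℝ → ℝ → (Fin d → ℝ)),
    Measurable (Function.uncurry f) ∧ Measurable (Function.uncurry g) ∧ δ.IsSpectral f g}

end CovarianceGame

end

noncomputable section

namespace CovarianceGame

/-! ### Linear algebra of positive definite matrices -/

section LinearAlgebra

variable {d : ℕ}

/-! In terms of the precision matrix `P = A⁻¹` the loss is `tr(P S) - log|P| - log|S| - d`, which is
convex in `P`: the gap above the tangent at `Q` is itself an entropy loss, that of `Q` against `P`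
(`entropyLoss_tangent`). The condition `‖A‖ ≤ B` becomes `P ≥ B⁻¹`, again convex. Averaging
precisions, over a seed or over a compact group, therefore stays in the parameter space and does not
increase the risk (`entropyLoss_averageEstimate_le`).

The group is `O(d) × O(n)`: `O(d)` rotates the observations, while `O(n)` mixes them and preserves
every sampling law. Haar averaging turns any randomized estimator into a deterministic equivariant
one with no larger worst-case risk (`exists_equivariant_risk_le`).

Attainment needs a compactness substitute. The equivariant estimators with worst-case risk at most
`R* + 1/(k+1)` form decreasing classes closed under harmonic means. The trace gap between arithmetic
and harmonic mean controls the squared Frobenius distance (`sum_sq_sub_le_trace`), so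
near-minimizers of the expected trace are Cauchy in `L²` and, at a fast enough rate, converge almost
everywhere (`exists_seq_tendsto`). One reference law suffices because all sampling laws are
absolutely continuous with respect to the standard one. The loss blows up at singular limits, so
Fatou's lemma shows that the limit is minimax.

`O(n)`-invariance makes the estimate a function of `S_n` alone, since samples with equal Gram
matrices differ by a mixing. `O(d)`-equivariance under sign changes makes it diagonal in an
eigenbasis of `S_n`. With `g(x, y) = (y, y², …, y^d)`, the sum over `j ≠ i` together with the powers
of `Δᵢ` gives all power sums, hence the whole spectrum; then `f` looks up the value belonging to
`Δᵢ`. The minimax estimator thus lies in `spectralEstimators` exactly, and the approximation in (i)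
is trivial. For (ii), spectral estimators are invariant, and the risk of an invariant estimator
depends only on the spectrum of the parameter. -/

open scoped MatrixOrder in
lemma exists_eq_transpose_mul_self {A : Matrix (Fin d) (Fin d) ℝ} (hA : A.PosSemidef) :
    ∃ C : Matrix (Fin d) (Fin d) ℝ, A = Cᵀ * C := by
  obtain ⟨C, hC⟩ := CStarAlgebra.nonneg_iff_eq_star_mul_self.mp hA.nonneg
  exact ⟨C, by rw [hC, Matrix.star_eq_conjTranspose, Matrix.conjTranspose_eq_transpose_of_trivial]⟩

lemma posSemidef_conj {A : Matrix (Fin d) (Fin d) ℝ} (hA : A.PosSemidef)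
    (C : Matrix (Fin d) (Fin d) ℝ) : (C * A * Cᵀ).PosSemidef := by
  simpa [Matrix.conjTranspose_eq_transpose_of_trivial] using hA.mul_mul_conjTranspose_same C

lemma posDef_conj {A C : Matrix (Fin d) (Fin d) ℝ} (hA : A.PosDef) (hC : IsUnit C) :
    (C * A * Cᵀ).PosDef := by
  have h := Matrix.IsUnit.posDef_star_right_conjugate_iff (x := A) hC
  rw [Matrix.star_eq_conjTranspose, Matrix.conjTranspose_eq_transpose_of_trivial] at h
  exact h.2 hA

/-- With `A = KᵀK` an entry is an inner product of two columns of `K`, at most the mean of two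
diagonal entries of `A`. This lets the trace dominate every entry. -/
lemma norm_entry_le_trace {A : Matrix (Fin d) (Fin d) ℝ} (hA : A.PosSemidef) (i j : Fin d) :
    ‖A i j‖ ≤ A.trace := by
  obtain ⟨K, rfl⟩ := exists_eq_transpose_mul_self hA
  have h : ∀ i j, (Kᵀ * K) i j = ∑ k, K k i * K k j := fun i j => by
    simp [Matrix.mul_apply]
  have htr : (Kᵀ * K).trace = ∑ l, ∑ k, K k l * K k l := by
    simp [Matrix.trace, h]
  have hle : ∀ l, ∑ k, K k l * K k l ≤ (Kᵀ * K).trace := fun l => by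
    rw [htr]
    exact Finset.single_le_sum (f := fun l => ∑ k, K k l * K k l)
      (fun l _ => Finset.sum_nonneg fun k _ => mul_self_nonneg _) (Finset.mem_univ l)
  have h1 := hle i
  have h2 := hle j
  rw [h, Real.norm_eq_abs]
  refine (Finset.abs_sum_le_sum_abs _ _).trans ?_
  have h3 : ∑ k, |K k i * K k j| ≤ ∑ k, (K k i * K k i + K k j * K k j) / 2 :=
    Finset.sum_le_sum fun k _ => by
      rw [abs_mul]
      nlinarith [sq_nonneg (|K k i| - |K k j|), abs_mul_abs_self (K k i), abs_mul_abs_self (K k j)]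
  rw [← Finset.sum_div, Finset.sum_add_distrib] at h3
  linarith

/-- Sum `log t ≤ t - 1` over the eigenvalues. -/
lemma trace_sub_log_det_nonneg {W : Matrix (Fin d) (Fin d) ℝ} (hW : W.PosDef) :
    0 ≤ W.trace - Real.log W.det - d := by
  have h1 := hW.isHermitian.trace_eq_sum_eigenvalues
  have h2 := hW.isHermitian.det_eq_prod_eigenvalues
  simp only [RCLike.ofReal_real_eq_id, id_eq] at h1 h2
  rw [h1, h2, Real.log_prod fun i _ => (hW.eigenvalues_pos i).ne']
  have : ∑ i : Fin d, (1 : ℝ) = d := by simp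
  rw [← this, ← Finset.sum_sub_distrib, ← Finset.sum_sub_distrib]
  exact Finset.sum_nonneg fun i _ => by
    linarith [Real.log_le_sub_one_of_pos (hW.eigenvalues_pos i)]

/-- A congruence turning `A⁻¹ S` into a positive definite matrix. -/
lemma exists_posDef_trace_det {P S : Matrix (Fin d) (Fin d) ℝ} (hP : P.PosDef) (hS : S.PosDef) :
    ∃ W : Matrix (Fin d) (Fin d) ℝ, W.PosDef ∧ W.trace = (P * S).trace ∧
      W.det = (P * S).det := by
  -- `P S` need not be symmetric; `K S Kᵀ` is, and has the same trace by cyclicity and the same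
  -- determinant.
  obtain ⟨K, rfl⟩ := exists_eq_transpose_mul_self hP.posSemidef
  have hK : IsUnit K := by
    have := hP.isUnit
    rw [Matrix.isUnit_iff_isUnit_det, Matrix.det_mul] at this
    rw [Matrix.isUnit_iff_isUnit_det]
    exact isUnit_of_mul_isUnit_right this
  refine ⟨K * S * Kᵀ, posDef_conj hS hK, ?_, ?_⟩
  · rw [Matrix.trace_mul_comm, ← Matrix.mul_assoc]
  · simp only [Matrix.det_mul, Matrix.det_transpose]; ring

lemma entropyLoss_nonneg {A S : Matrix (Fin d) (Fin d) ℝ} (hA : A.PosDef) (hS : S.PosDef) :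
    0 ≤ entropyLoss A S := by
  obtain ⟨W, hW, h1, h2⟩ := exists_posDef_trace_det hA.inv hS
  rw [entropyLoss, ← h1, ← h2]
  exact trace_sub_log_det_nonneg hW

lemma entropyLoss_eq {A S : Matrix (Fin d) (Fin d) ℝ} (hA : A.PosDef) (hS : S.PosDef) :
    entropyLoss A S = (A⁻¹ * S).trace + Real.log A.det - Real.log S.det - d := by
  rw [entropyLoss, Matrix.det_mul, Real.log_mul hA.inv.det_pos.ne' hS.det_pos.ne',
    Matrix.det_nonsing_inv, Ring.inverse_eq_inv', Real.log_inv]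
  ring

lemma entropyLoss_inv_eq {P S : Matrix (Fin d) (Fin d) ℝ} (hP : P.PosDef) (hS : S.PosDef) :
    entropyLoss P⁻¹ S = (P * S).trace - Real.log P.det - Real.log S.det - d := by
  rw [entropyLoss_eq hP.inv hS, Matrix.nonsing_inv_nonsing_inv _ hP.det_pos.ne'.isUnit,
    Matrix.det_nonsing_inv, Ring.inverse_eq_inv', Real.log_inv]
  ring

/-- The entropy loss, as a function of the precision matrix, lies above its tangents. -/
lemma entropyLoss_tangent {P Q S : Matrix (Fin d) (Fin d) ℝ} (hP : P.PosDef) (hQ : Q.PosDef)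
    (hS : S.PosDef) :
    entropyLoss Q⁻¹ S + ((P - Q) * (S - Q⁻¹)).trace ≤ entropyLoss P⁻¹ S := by
  -- The gap to be bounded is exactly `entropyLoss Q P`.
  have h := entropyLoss_nonneg hQ hP
  rw [entropyLoss_eq hQ hP] at h
  rw [entropyLoss_inv_eq hP hS, entropyLoss_inv_eq hQ hS]
  have h2 : Q * Q⁻¹ = 1 := Matrix.mul_nonsing_inv _ hQ.det_pos.ne'.isUnit
  have h3 : (Q⁻¹ * P).trace = (P * Q⁻¹).trace := Matrix.trace_mul_comm _ _
  simp only [Matrix.sub_mul, Matrix.mul_sub, Matrix.trace_sub, h2, Matrix.trace_one,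
    Fintype.card_fin]
  linarith

/-- Applying the basic inequality to `W / 2` spends only half of the trace on the logarithm; the
other half is controlled by the loss. -/
lemma trace_le_entropyLoss {A S : Matrix (Fin d) (Fin d) ℝ} (hA : A.PosDef) (hS : S.PosDef) :
    (A⁻¹ * S).trace ≤ 2 * (entropyLoss A S + d * Real.log 2) := by
  obtain ⟨W, hW, h1, h2⟩ := exists_posDef_trace_det hA.inv hS
  have h := trace_sub_log_det_nonneg (W := (2 : ℝ)⁻¹ • W) (hW.smul (by norm_num))
  rw [Matrix.det_smul, Fintype.card_fin, Matrix.trace_smul, Real.log_mul (by positivity)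
    hW.det_pos.ne', Real.log_pow, Real.log_inv, smul_eq_mul] at h
  rw [entropyLoss, ← h1, ← h2]
  linarith

/-- The form that forces the loss to infinity as `det A → 0`. -/
lemma neg_log_det_le_entropyLoss {A S : Matrix (Fin d) (Fin d) ℝ} (hA : A.PosDef)
    (hS : S.PosDef) :
    Real.log S.det - Real.log A.det + d - 2 * (d * Real.log 2) ≤ entropyLoss A S := by
  have h1 := trace_le_entropyLoss hA hS
  have h2 := entropyLoss_eq hA hS
  linarith

lemma isUnit_of_mem_orthogonal {g : Matrix (Fin d) (Fin d) ℝ}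
    (hg : g ∈ Matrix.orthogonalGroup (Fin d) ℝ) : IsUnit g :=
  IsUnit.of_mul_eq_one gᵀ ((Matrix.mem_orthogonalGroup_iff (Fin d) ℝ).1 hg)

lemma inv_of_mem_orthogonal {g : Matrix (Fin d) (Fin d) ℝ}
    (hg : g ∈ Matrix.orthogonalGroup (Fin d) ℝ) : g⁻¹ = gᵀ :=
  Matrix.inv_eq_right_inv ((Matrix.mem_orthogonalGroup_iff (Fin d) ℝ).1 hg)

lemma inv_conj_orthogonal {g : Matrix (Fin d) (Fin d) ℝ}
    (hg : g ∈ Matrix.orthogonalGroup (Fin d) ℝ) (A : Matrix (Fin d) (Fin d) ℝ) :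
    (g * A * gᵀ)⁻¹ = g * A⁻¹ * gᵀ := by
  have h := inv_of_mem_orthogonal hg
  have h' : (gᵀ)⁻¹ = g := by
    rw [← h, Matrix.nonsing_inv_nonsing_inv _
      ((Matrix.isUnit_iff_isUnit_det g).1 (isUnit_of_mem_orthogonal hg))]
  rw [Matrix.mul_inv_rev, Matrix.mul_inv_rev, h, h', Matrix.mul_assoc]

lemma transpose_mem_orthogonal {g : Matrix (Fin d) (Fin d) ℝ}
    (hg : g ∈ Matrix.orthogonalGroup (Fin d) ℝ) : gᵀ ∈ Matrix.orthogonalGroup (Fin d) ℝ := by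
  rw [Matrix.mem_orthogonalGroup_iff]
  simpa using (Matrix.mem_orthogonalGroup_iff' (Fin d) ℝ).1 hg

lemma orthogonal_mul_transpose {g : Matrix (Fin d) (Fin d) ℝ}
    (hg : g ∈ Matrix.orthogonalGroup (Fin d) ℝ) : g * gᵀ = 1 :=
  (Matrix.mem_orthogonalGroup_iff (Fin d) ℝ).1 hg

lemma orthogonal_transpose_mul {g : Matrix (Fin d) (Fin d) ℝ}
    (hg : g ∈ Matrix.orthogonalGroup (Fin d) ℝ) : gᵀ * g = 1 :=
  (Matrix.mem_orthogonalGroup_iff' (Fin d) ℝ).1 hg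

lemma transpose_mul_conj_mul {g : Matrix (Fin d) (Fin d) ℝ}
    (hg : g ∈ Matrix.orthogonalGroup (Fin d) ℝ) (M : Matrix (Fin d) (Fin d) ℝ) :
    gᵀ * (g * M * gᵀ) * g = M := by
  rw [Matrix.mul_assoc, Matrix.mul_assoc, Matrix.mul_assoc, orthogonal_transpose_mul hg,
    Matrix.mul_one, ← Matrix.mul_assoc, orthogonal_transpose_mul hg, Matrix.one_mul]

lemma entropyLoss_conj {g : Matrix (Fin d) (Fin d) ℝ}
    (hg : g ∈ Matrix.orthogonalGroup (Fin d) ℝ) (A S : Matrix (Fin d) (Fin d) ℝ) :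
    entropyLoss (g * A * gᵀ) (g * S * gᵀ) = entropyLoss A S := by
  have h : (g * A * gᵀ)⁻¹ * (g * S * gᵀ) = g * (A⁻¹ * S) * gᵀ := by
    rw [inv_conj_orthogonal hg]
    calc g * A⁻¹ * gᵀ * (g * S * gᵀ) = g * A⁻¹ * (gᵀ * g) * S * gᵀ := by
          simp only [Matrix.mul_assoc]
      _ = _ := by rw [orthogonal_transpose_mul hg]; simp only [Matrix.mul_assoc, Matrix.one_mul]
  have hdet : g.det * gᵀ.det = 1 := by
    rw [← Matrix.det_mul, orthogonal_mul_transpose hg, Matrix.det_one]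
  rw [entropyLoss, h, entropyLoss, Matrix.trace_mul_comm, ← Matrix.mul_assoc,
    orthogonal_transpose_mul hg, Matrix.one_mul, Matrix.det_mul, Matrix.det_mul g,
    mul_right_comm, hdet, one_mul]

/-! ### The parameter space -/

lemma posSemidef_smul_one_sub_iff {S : Matrix (Fin d) (Fin d) ℝ} (hS : S.PosSemidef) {B : ℝ} :
    (B • (1 : Matrix (Fin d) (Fin d) ℝ) - S).PosSemidef ↔
      ∀ x : Fin d → ℝ, x ⬝ᵥ S *ᵥ x ≤ B * (x ⬝ᵥ x) := by
  rw [Matrix.posSemidef_iff_dotProduct_mulVec]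
  have hH : (B • (1 : Matrix (Fin d) (Fin d) ℝ) - S).IsHermitian := by
    refine Matrix.IsHermitian.sub ?_ hS.isHermitian
    rw [Matrix.IsHermitian, Matrix.conjTranspose_eq_transpose_of_trivial]; simp
  simp only [hH, true_and, star_trivial, Matrix.sub_mulVec, Matrix.smul_mulVec, Matrix.one_mulVec,
    dotProduct_sub, dotProduct_smul, smul_eq_mul, sub_nonneg]

/-- Cauchy–Schwarz in one direction; in the other, `S = CᵀC` and the C*-identity. From here on the
norm bound is a Loewner inequality. -/
lemma opNorm_le_iff {S : Matrix (Fin d) (Fin d) ℝ} (hS : S.PosSemidef) {B : ℝ} (hB : 0 ≤ B) :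
    opNorm S ≤ B ↔ (B • (1 : Matrix (Fin d) (Fin d) ℝ) - S).PosSemidef := by
  rw [posSemidef_smul_one_sub_iff hS]
  constructor
  · intro h x
    have h1 := real_inner_le_norm (WithLp.toLp 2 x)
      (Matrix.toEuclideanCLM (n := Fin d) (𝕜 := ℝ) S (WithLp.toLp 2 x))
    rw [Matrix.inner_toEuclideanCLM] at h1
    have h2 := (Matrix.toEuclideanCLM (n := Fin d) (𝕜 := ℝ) S).le_of_opNorm_le h (WithLp.toLp 2 x)
    have h3 : ‖WithLp.toLp 2 x‖ * ‖WithLp.toLp 2 x‖ = x ⬝ᵥ x := by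
      rw [← sq, EuclideanSpace.real_norm_sq_eq]
      simp [dotProduct, sq]
    simp only [] at h1
    nlinarith [norm_nonneg (WithLp.toLp 2 x)]
  · intro h
    obtain ⟨C, rfl⟩ := exists_eq_transpose_mul_self hS
    have hC : ‖Matrix.toEuclideanCLM (n := Fin d) (𝕜 := ℝ) C‖ ≤ Real.sqrt B := by
      refine ContinuousLinearMap.opNorm_le_bound _ (Real.sqrt_nonneg _) fun x => ?_
      refine abs_le_of_sq_le_sq' ?_ (by positivity) |>.2
      rw [mul_pow, Real.sq_sqrt hB, EuclideanSpace.real_norm_sq_eq, EuclideanSpace.real_norm_sq_eq]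
      have := h x.ofLp
      rw [← Matrix.mulVec_mulVec, Matrix.dotProduct_mulVec, Matrix.vecMul_transpose] at this
      simpa [dotProduct, sq] using this
    have : opNorm (Cᵀ * C) = ‖Matrix.toEuclideanCLM (n := Fin d) (𝕜 := ℝ) C‖ *
        ‖Matrix.toEuclideanCLM (n := Fin d) (𝕜 := ℝ) C‖ := by
      rw [opNorm, map_mul, ← CStarRing.norm_star_mul_self, ← map_star,
        Matrix.star_eq_conjTranspose, Matrix.conjTranspose_eq_transpose_of_trivial]
    rw [this]
    calc _ ≤ Real.sqrt B * Real.sqrt B := by gcongr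
      _ = B := Real.mul_self_sqrt hB

lemma mem_paramSpace_iff {S : Matrix (Fin d) (Fin d) ℝ} {B : ℝ} (hB : 0 ≤ B) :
    S ∈ paramSpace d B ↔ S.PosDef ∧ (B • (1 : Matrix (Fin d) (Fin d) ℝ) - S).PosSemidef :=
  and_congr_right fun h => opNorm_le_iff h.posSemidef hB

/-- Inversion reverses the Loewner order against multiples of the identity. -/
lemma posSemidef_smul_one_sub_inv {S : Matrix (Fin d) (Fin d) ℝ} (hS : S.PosDef) {c : ℝ}
    (hc : 0 < c) (h : (S - c • (1 : Matrix (Fin d) (Fin d) ℝ)).PosSemidef) :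
    (c⁻¹ • (1 : Matrix (Fin d) (Fin d) ℝ) - S⁻¹).PosSemidef := by
  rw [posSemidef_smul_one_sub_iff hS.inv.posSemidef]
  intro x
  set y := S⁻¹ *ᵥ x with hy
  have h1 := h.dotProduct_mulVec_nonneg y
  simp only [star_trivial, Matrix.sub_mulVec, Matrix.smul_mulVec, Matrix.one_mulVec,
    dotProduct_sub, dotProduct_smul, smul_eq_mul, sub_nonneg] at h1
  have h2 : S *ᵥ y = x := by
    rw [hy, Matrix.mulVec_mulVec, Matrix.mul_nonsing_inv _ hS.det_pos.ne'.isUnit,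
      Matrix.one_mulVec]
  rw [h2] at h1
  -- Expanding this square and using `c (y ⬝ᵥ y) ≤ y ⬝ᵥ x` gives the claim without a square root of
  -- `S`.
  have h3 : 0 ≤ (c • y - x) ⬝ᵥ (c • y - x) := by
    simpa using dotProduct_star_self_nonneg (c • y - x)
  simp only [sub_dotProduct, dotProduct_sub, smul_dotProduct, dotProduct_smul, smul_eq_mul] at h3
  rw [dotProduct_comm x y] at h3 ⊢
  rw [inv_mul_eq_div, le_div_iff₀ hc]
  nlinarith

/-- In precision coordinates the constraint is the convex condition `S⁻¹ ≥ B⁻¹`, which averages of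
precisions inherit. -/
lemma mem_paramSpace_iff_inv {S : Matrix (Fin d) (Fin d) ℝ} {B : ℝ} (hB : 0 < B) :
    S ∈ paramSpace d B ↔
      S.PosDef ∧ (S⁻¹ - B⁻¹ • (1 : Matrix (Fin d) (Fin d) ℝ)).PosSemidef := by
  rw [mem_paramSpace_iff hB.le]
  refine and_congr_right fun hS => ⟨fun h => ?_, fun h => ?_⟩
  · rw [posSemidef_smul_one_sub_iff hS.posSemidef] at h
    have hsymm : Sᵀ = S := by
      simpa [Matrix.IsHermitian, Matrix.conjTranspose_eq_transpose_of_trivial] using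
        hS.isHermitian
    refine Matrix.PosSemidef.of_dotProduct_mulVec_nonneg ?_ fun x => ?_
    · refine Matrix.IsHermitian.sub hS.inv.isHermitian ?_
      rw [Matrix.IsHermitian, Matrix.conjTranspose_eq_transpose_of_trivial]; simp
    set y := S⁻¹ *ᵥ x with hy
    have h2 : S *ᵥ y = x := by
      rw [hy, Matrix.mulVec_mulVec, Matrix.mul_nonsing_inv _ hS.det_pos.ne'.isUnit,
        Matrix.one_mulVec]
    -- The quadratic form of `S` at `S⁻¹ x - B⁻¹ x` contains `x ⬝ᵥ S⁻¹ x`, the term to be bounded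
    -- below.
    have h1 := hS.posSemidef.dotProduct_mulVec_nonneg (y - B⁻¹ • x)
    have h3 : y ⬝ᵥ S *ᵥ x = x ⬝ᵥ x := by
      rw [Matrix.dotProduct_mulVec, ← Matrix.mulVec_transpose, hsymm, h2]
    have h4 := h x
    simp only [star_trivial, Matrix.sub_mulVec, Matrix.smul_mulVec, Matrix.one_mulVec,
      Matrix.mulVec_sub, Matrix.mulVec_smul, sub_dotProduct, smul_dotProduct,
      dotProduct_sub, dotProduct_smul, smul_eq_mul, sub_nonneg, h2, h3] at h1 ⊢
    rw [dotProduct_comm y x] at h1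
    rw [← hy]
    have h5 : B⁻¹ * (B⁻¹ * (x ⬝ᵥ S *ᵥ x)) ≤ B⁻¹ * (B⁻¹ * (B * (x ⬝ᵥ x))) := by gcongr
    rw [inv_mul_cancel_left₀ hB.ne'] at h5
    linarith
  · have := posSemidef_smul_one_sub_inv hS.inv (inv_pos.2 hB) h
    rwa [inv_inv, Matrix.nonsing_inv_nonsing_inv _ hS.det_pos.ne'.isUnit] at this

end LinearAlgebra

/-! ### The law of the sample -/

section Law

variable {n d : ℕ}

lemma absolutelyContinuous_pi_fin {α : Type*} [MeasurableSpace α] :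
    ∀ {m : ℕ} (μ ν : Fin m → Measure α) [∀ i, SigmaFinite (μ i)] [∀ i, SigmaFinite (ν i)],
      (∀ i, μ i ≪ ν i) → Measure.pi μ ≪ Measure.pi ν := by
  intro m
  induction m with
  | zero =>
    intro μ ν _ _ _
    rw [Measure.pi_of_empty, Measure.pi_of_empty]
  | succ m ih =>
    intro μ ν _ _ h
    have h1 := measurePreserving_piFinSuccAbove μ 0
    have h2 := measurePreserving_piFinSuccAbove ν 0
    have h3 : (μ 0).prod (Measure.pi fun j => μ (Fin.succAbove 0 j)) ≪
        (ν 0).prod (Measure.pi fun j => ν (Fin.succAbove 0 j)) :=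
      (h 0).prod (ih _ _ fun i => h _)
    rw [← h1.map_eq, ← h2.map_eq] at h3
    have h4 := h3.map (MeasurableEquiv.piFinSuccAbove (fun _ => α) 0).symm.measurable
    simpa only [MeasurableEquiv.map_symm_map] using h4

lemma stdGaussian_absolutelyContinuous :
    stdGaussian (EuclideanSpace ℝ (Fin d)) ≪ volume := by
  rw [← map_pi_eq_stdGaussian, ← (PiLp.volume_preserving_toLp (Fin d)).map_eq]
  exact (absolutelyContinuous_pi_fin _ _ fun _ =>
    gaussianReal_absolutelyContinuous 0 one_ne_zero).map
      (PiLp.volume_preserving_toLp (Fin d)).measurable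

lemma volume_absolutelyContinuous_stdGaussian :
    (volume : Measure (EuclideanSpace ℝ (Fin d))) ≪ stdGaussian (EuclideanSpace ℝ (Fin d)) := by
  rw [← map_pi_eq_stdGaussian, ← (PiLp.volume_preserving_toLp (Fin d)).map_eq]
  exact (absolutelyContinuous_pi_fin _ _ fun _ =>
    gaussianReal_absolutelyContinuous' 0 one_ne_zero).map
      (PiLp.volume_preserving_toLp (Fin d)).measurable

instance : IsProbabilityMeasure (sampleLaw n (S : Matrix (Fin d) (Fin d) ℝ)) := by
  unfold sampleLaw; infer_instance

open scoped MatrixOrder in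
-- `N(0, S)` is the image of the standard Gaussian under the square root of `S`, an invertible map,
-- which sends Lebesgue null sets back to null sets.
lemma multivariateGaussian_absolutelyContinuous {S : Matrix (Fin d) (Fin d) ℝ} (hS : S.PosDef) :
    multivariateGaussian 0 S ≪ multivariateGaussian 0 (1 : Matrix (Fin d) (Fin d) ℝ) := by
  rw [multivariateGaussian_zero_one]
  refine Measure.AbsolutelyContinuous.trans ?_ volume_absolutelyContinuous_stdGaussian
  have hdet : LinearMap.det (Matrix.toEuclideanCLM (n := Fin d) (𝕜 := ℝ) (CFC.sqrt S) :
      EuclideanSpace ℝ (Fin d) →ₗ[ℝ] EuclideanSpace ℝ (Fin d)) ≠ 0 := by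
    rw [Matrix.coe_toEuclideanCLM_eq_toEuclideanLin, LinearMap.det_toLpLin,
      hS.posSemidef.det_sqrt]
    simpa [Real.sqrt_eq_zero'] using hS.det_pos
  have hq := Measure.LinearMap.quasiMeasurePreserving
    (volume : Measure (EuclideanSpace ℝ (Fin d))) _ hdet
  rw [multivariateGaussian]
  simp only [zero_add]
  exact (stdGaussian_absolutelyContinuous.map hq.measurable).trans hq.absolutelyContinuous

/-- Almost sure convergence under the single law with covariance `1` thereby holds under every
parameter. -/
lemma sampleLaw_absolutelyContinuous {S : Matrix (Fin d) (Fin d) ℝ} (hS : S.PosDef) :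
    sampleLaw n S ≪ sampleLaw n (1 : Matrix (Fin d) (Fin d) ℝ) :=
  absolutelyContinuous_pi_fin _ _ fun _ => multivariateGaussian_absolutelyContinuous hS

/-- A Gaussian law is determined by its mean and its covariance form, and the latter is pulled back
along the adjoint of `g`. -/
lemma map_multivariateGaussian {S : Matrix (Fin d) (Fin d) ℝ} (hS : S.PosSemidef)
    (g : Matrix (Fin d) (Fin d) ℝ) :
    (multivariateGaussian 0 S).map (Matrix.toEuclideanCLM (n := Fin d) (𝕜 := ℝ) g) =
      multivariateGaussian 0 (g * S * gᵀ) := by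
  apply IsGaussian.ext
  · simp only [id_eq, integral_id_multivariateGaussian]
    rw [ContinuousLinearMap.integral_id_map, integral_id_multivariateGaussian, map_zero]
    exact IsGaussian.integrable_id
  · ext x y
    rw [covarianceBilin_map IsGaussian.memLp_two_id, covarianceBilin_multivariateGaussian hS,
      covarianceBilin_multivariateGaussian (posSemidef_conj hS g)]
    have : (Matrix.toEuclideanCLM (n := Fin d) (𝕜 := ℝ) g).adjoint =
        Matrix.toEuclideanCLM (n := Fin d) (𝕜 := ℝ) gᵀ := by
      rw [← ContinuousLinearMap.star_eq_adjoint, ← map_star, Matrix.star_eq_conjTranspose,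
        Matrix.conjTranspose_eq_transpose_of_trivial]
    rw [this, Matrix.ofLp_toEuclideanCLM, Matrix.ofLp_toEuclideanCLM, Matrix.mulVec_mulVec,
      Matrix.dotProduct_mulVec, Matrix.mulVec_transpose, Matrix.vecMul_vecMul,
      Matrix.dotProduct_mulVec, Matrix.mul_assoc]

lemma measurable_actSample (g : Matrix (Fin d) (Fin d) ℝ) :
    Measurable (actSample g : Sample n d → Sample n d) :=
  measurable_pi_lambda _ fun k =>
    (Matrix.toEuclideanCLM (n := Fin d) (𝕜 := ℝ) g).continuous.measurable.comp
      (measurable_pi_apply k)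

lemma map_actSample_sampleLaw {S : Matrix (Fin d) (Fin d) ℝ} (hS : S.PosSemidef)
    (g : Matrix (Fin d) (Fin d) ℝ) :
    (sampleLaw n S).map (actSample g) = sampleLaw n (g * S * gᵀ) := by
  have h := Measure.pi_map_pi (μ := fun _ : Fin n => multivariateGaussian 0 S)
    (f := fun _ => Matrix.toEuclideanCLM (n := Fin d) (𝕜 := ℝ) g)
    (hμ := fun _ => by rw [map_multivariateGaussian hS]; infer_instance)
    (fun _ => (ContinuousLinearMap.continuous _).aemeasurable)
  simp only [map_multivariateGaussian hS] at h
  exact h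

/-- The action of an `n × n` matrix on the data by linear combinations of the observations. -/
def mixSample (o : Matrix (Fin n) (Fin n) ℝ) (X : Sample n d) : Sample n d :=
  fun k => ∑ l, o k l • X l

/-- `mixSample` as a continuous linear map. -/
def mixSampleCLM (o : Matrix (Fin n) (Fin n) ℝ) : Sample n d →L[ℝ] Sample n d :=
  ContinuousLinearMap.pi fun k => ∑ l, o k l • ContinuousLinearMap.proj l

lemma coe_mixSampleCLM (o : Matrix (Fin n) (Fin n) ℝ) :
    ⇑(mixSampleCLM o : Sample n d →L[ℝ] Sample n d) = mixSample o := by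
  ext X k i
  simp [mixSampleCLM, mixSample]

/-- The characteristic function of the sample is `exp(-½ ∑ q(K_k, K_k))`, where `K_k` are the
components of the functional; an orthogonal change of these components leaves the sum unchanged. -/
lemma map_mixSample_sampleLaw {o : Matrix (Fin n) (Fin n) ℝ}
    (ho : o ∈ Matrix.orthogonalGroup (Fin n) ℝ) (S : Matrix (Fin d) (Fin d) ℝ) :
    (sampleLaw n S).map (mixSample o) = sampleLaw n S := by
  have : IsProbabilityMeasure ((sampleLaw n S).map (mixSample o)) :=
    Measure.isProbabilityMeasure_map
      (by rw [← coe_mixSampleCLM]; exact (ContinuousLinearMap.continuous _).aemeasurable)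
  refine Measure.ext_of_charFunDual (funext fun L => ?_)
  rw [← coe_mixSampleCLM, charFunDual_map, sampleLaw, charFunDual_pi, charFunDual_pi]
  set q := covarianceBilinDual (multivariateGaussian 0 S) with hq
  have hchar : ∀ l : StrongDual ℝ (EuclideanSpace ℝ (Fin d)),
      charFunDual (multivariateGaussian 0 S) l = Complex.exp (-(q l l : ℂ) / 2) := fun l => by
    rw [IsGaussian.charFunDual_eq', integral_id_multivariateGaussian']
    simp [hq, neg_div]
  set K : Fin n → StrongDual ℝ (EuclideanSpace ℝ (Fin d)) := fun k =>
    L ∘SL ContinuousLinearMap.single ℝ (fun _ => EuclideanSpace ℝ (Fin d)) k with hK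
  have hcomp : ∀ l : Fin n, (L ∘SL mixSampleCLM o) ∘SL
      ContinuousLinearMap.single ℝ (fun _ => EuclideanSpace ℝ (Fin d)) l = ∑ k, o k l • K k := by
    intro l
    ext x
    have h1 : mixSampleCLM o (Pi.single l x : Sample n d) =
        ∑ k, o k l • (Pi.single k x : Sample n d) := by
      rw [coe_mixSampleCLM]
      funext k
      simp only [mixSample, Finset.sum_apply, Pi.smul_apply]
      rw [Finset.sum_eq_single l, Finset.sum_eq_single k] <;>
        simp +contextual [eq_comm]
    simp [hK, h1]
  simp only [hcomp, hchar]
  rw [← Complex.exp_sum, ← Complex.exp_sum]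
  congr 1
  rw [← Finset.sum_div, ← Finset.sum_div, Finset.sum_neg_distrib, Finset.sum_neg_distrib]
  congr 2
  norm_cast
  have hoo : ∀ k k', ∑ l, o k l * o k' l = if k = k' then 1 else 0 := fun k k' => by
    have := congrFun (congrFun (orthogonal_mul_transpose ho) k) k'
    simpa [Matrix.mul_apply, Matrix.one_apply] using this
  calc ∑ l, q (∑ k, o k l • K k) (∑ k, o k l • K k)
      = ∑ l, ∑ k, ∑ k', o k l * o k' l * q (K k) (K k') := by
        refine Finset.sum_congr rfl fun l _ => ?_
        simp only [map_sum, map_smul, _root_.sum_apply,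
          _root_.smul_apply, smul_eq_mul, Finset.mul_sum]
        rw [Finset.sum_comm]
        refine Finset.sum_congr rfl fun k _ => Finset.sum_congr rfl fun k' _ => by ring
    _ = ∑ k, ∑ k', (∑ l, o k l * o k' l) * q (K k) (K k') := by
        rw [Finset.sum_comm]
        refine Finset.sum_congr rfl fun k _ => ?_
        rw [Finset.sum_comm]
        simp only [Finset.sum_mul]
    _ = ∑ k, q (K k) (K k) := by simp [hoo]

lemma measurable_mixSample (o : Matrix (Fin n) (Fin n) ℝ) :
    Measurable (mixSample o : Sample n d → Sample n d) := by
  rw [← coe_mixSampleCLM]; exact (ContinuousLinearMap.continuous _).measurable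

lemma empiricalCov_apply (X : Sample n d) (i j : Fin d) :
    empiricalCov X i j = (n : ℝ)⁻¹ * ∑ k, X k i * X k j := by
  simp [empiricalCov, Matrix.sum_apply, Matrix.vecMulVec_apply]

lemma empiricalCov_actSample (g : Matrix (Fin d) (Fin d) ℝ) (X : Sample n d) :
    empiricalCov (actSample g X) = g * empiricalCov X * gᵀ := by
  simp only [empiricalCov, actSample, Matrix.mul_smul, Matrix.smul_mul, Finset.mul_sum,
    Finset.sum_mul, Matrix.mul_vecMulVec, Matrix.vecMulVec_mul, Matrix.vecMul_transpose]

lemma posSemidef_empiricalCov (X : Sample n d) : (empiricalCov X).PosSemidef := by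
  refine Matrix.PosSemidef.smul (Matrix.posSemidef_sum _ fun k _ => ?_) (by positivity)
  simpa using Matrix.posSemidef_vecMulVec_self_star (X k).ofLp

/-- Two samples with the same empirical covariance matrix differ by an orthogonal mixing of the
observations. -/
lemma exists_mixSample_eq (hn : 0 < n) {X Y : Sample n d} (h : empiricalCov X = empiricalCov Y) :
    ∃ o ∈ Matrix.orthogonalGroup (Fin n) ℝ, mixSample o X = Y := by
  have hn' : (n : ℝ) ≠ 0 := by exact_mod_cast hn.ne'
  -- The two `n × d` data matrices have the same Gram matrix, so `MX u` and `MY u` always have equal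
  -- length.
  have hgram : ∀ i j, ∑ k, X k i * X k j = ∑ k, Y k i * Y k j := fun i j => by
    have := congrFun (congrFun h i) j
    rw [empiricalCov_apply, empiricalCov_apply] at this
    exact mul_left_cancel₀ (inv_ne_zero hn') this
  let MX : Matrix (Fin n) (Fin d) ℝ := fun k i => X k i
  let MY : Matrix (Fin n) (Fin d) ℝ := fun k i => Y k i
  let a := Matrix.toEuclideanLin MX
  let b := Matrix.toEuclideanLin MY
  have hG : MXᵀ * MX = MYᵀ * MY := by
    ext i j
    simpa [Matrix.mul_apply] using hgram i j
  have hsq : ∀ (M : Matrix (Fin n) (Fin d) ℝ) (u : EuclideanSpace ℝ (Fin d)),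
      ‖Matrix.toEuclideanLin M u‖ ^ 2 = u.ofLp ⬝ᵥ (Mᵀ * M) *ᵥ u.ofLp := fun M u => by
    rw [EuclideanSpace.real_norm_sq_eq, ← Matrix.mulVec_mulVec, Matrix.dotProduct_mulVec,
      Matrix.vecMul_transpose]
    simp [dotProduct, sq, Matrix.toLpLin_apply]
  have hab : ∀ u, ‖a u‖ = ‖b u‖ := fun u => by
    have : ‖a u‖ ^ 2 = ‖b u‖ ^ 2 := by rw [hsq, hsq, hG]
    exact (pow_left_inj₀ (norm_nonneg _) (norm_nonneg _) two_ne_zero).1 this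
  obtain ⟨s, hs⟩ := a.rangeRestrict.exists_rightInverse_of_surjective a.range_rangeRestrict
  have hs' : ∀ y, a (s y) = y := fun y => congrArg Subtype.val (LinearMap.congr_fun hs y)
  -- The isometry `MX u ↦ MY u`, defined through a linear section of `a`. It extends to all of `ℝⁿ`,
  -- and an isometric endomorphism is given by an orthogonal matrix.
  let L : LinearMap.range a →ₗᵢ[ℝ] EuclideanSpace ℝ (Fin n) :=
    { toLinearMap := b ∘ₗ s
      norm_map' := fun y => by
        rw [LinearMap.comp_apply, ← hab, hs']; rfl }
  have hL : ∀ u, L.extend (a u) = b u := fun u => by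
    have h1 := L.extend_apply ⟨a u, u, rfl⟩
    rw [h1]
    have h2 : b (s ⟨a u, u, rfl⟩ - u) = 0 := by
      rw [← norm_eq_zero, ← hab, map_sub, hs', sub_self, norm_zero]
    rw [map_sub, sub_eq_zero] at h2
    exact h2
  let T : EuclideanSpace ℝ (Fin n) →L[ℝ] EuclideanSpace ℝ (Fin n) :=
    L.extend.toContinuousLinearMap
  have hT : star T * T = 1 :=
    (ContinuousLinearMap.norm_map_iff_adjoint_comp_self T).1 fun x => L.extend.norm_map x
  set o := (Matrix.toEuclideanCLM (n := Fin n) (𝕜 := ℝ)).symm T with ho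
  have hoT : Matrix.toEuclideanCLM (n := Fin n) (𝕜 := ℝ) o = T := by
    rw [ho, StarAlgEquiv.apply_symm_apply]
  refine ⟨o, ?_, ?_⟩
  · rw [Matrix.mem_orthogonalGroup_iff', ← Matrix.conjTranspose_eq_transpose_of_trivial,
      ← Matrix.star_eq_conjTranspose]
    apply EquivLike.injective (Matrix.toEuclideanCLM (n := Fin n) (𝕜 := ℝ))
    rw [map_mul, map_star, hoT, hT, map_one]
  · funext k
    ext i
    have h1 := congrArg (fun v : EuclideanSpace ℝ (Fin n) => v k)
      (hL (EuclideanSpace.single i 1))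
    have h2 : L.extend (a (EuclideanSpace.single i 1)) =
        Matrix.toEuclideanCLM (n := Fin n) (𝕜 := ℝ) o (a (EuclideanSpace.single i 1)) := by
      rw [hoT]; rfl
    simp only [h2, Matrix.ofLp_toEuclideanCLM] at h1
    have h3 : ∀ M : Matrix (Fin n) (Fin d) ℝ,
        (Matrix.toEuclideanLin M (EuclideanSpace.single i 1)).ofLp = fun k => M k i := fun M => by
      ext; simp [Matrix.toLpLin_apply]
    simp only [a, b, h3] at h1
    simpa [mixSample, Matrix.mulVec, dotProduct, MX, MY] using h1

end Law

/-! ### Averaging precision matrices -/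

section Measurability

variable {m n d : ℕ}

/-! ### Borel structure on matrices and measurability of the loss. -/

instance : MeasurableSpace (Matrix (Fin m) (Fin n) ℝ) :=
  inferInstanceAs (MeasurableSpace (Fin m → Fin n → ℝ))

instance : BorelSpace (Matrix (Fin m) (Fin n) ℝ) :=
  inferInstanceAs (BorelSpace (Fin m → Fin n → ℝ))

instance : SecondCountableTopology (Matrix (Fin m) (Fin n) ℝ) :=
  inferInstanceAs (SecondCountableTopology (Fin m → Fin n → ℝ))

lemma measurable_matrix_iff {α : Type*} [MeasurableSpace α] {A : α → Matrix (Fin m) (Fin n) ℝ} :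
    Measurable A ↔ ∀ i j, Measurable fun x => A x i j := by
  refine ⟨fun h i j => (measurable_pi_apply j).comp ((measurable_pi_apply i).comp h), fun h => ?_⟩
  exact measurable_pi_lambda _ fun i => measurable_pi_lambda _ fun j => h i j

lemma measurable_matrix_inv : Measurable fun A : Matrix (Fin d) (Fin d) ℝ => A⁻¹ := by
  simp only [Matrix.inv_def, Ring.inverse_eq_inv']
  have h1 : Measurable fun A : Matrix (Fin d) (Fin d) ℝ => A.det :=
    (continuous_id.matrix_det).measurable
  have h2 : Measurable fun A : Matrix (Fin d) (Fin d) ℝ => A.adjugate :=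
    (continuous_id.matrix_adjugate).measurable
  exact h1.inv.smul h2

lemma measurable_entropyLoss (S : Matrix (Fin d) (Fin d) ℝ) :
    Measurable fun A : Matrix (Fin d) (Fin d) ℝ => entropyLoss A S := by
  have h : Measurable fun A : Matrix (Fin d) (Fin d) ℝ => A⁻¹ * S :=
    measurable_matrix_inv.mul_const S
  have h1 : Measurable fun A : Matrix (Fin d) (Fin d) ℝ => A.det :=
    (continuous_id.matrix_det).measurable
  have h2 : Measurable fun A : Matrix (Fin d) (Fin d) ℝ => A.trace :=
    (continuous_id.matrix_trace).measurable
  exact ((h2.comp h).sub (h1.comp h).log).sub_const _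

lemma Estimator.measurable {B : ℝ} (δ : Estimator n d B) : Measurable δ.est :=
  measurable_matrix_iff.2 δ.measurable_est

end Measurability

section Average

variable {d : ℕ} {Ω : Type*} [MeasurableSpace Ω]

lemma smul_one_mem_paramSpace {B : ℝ} (hB : 0 < B) :
    B • (1 : Matrix (Fin d) (Fin d) ℝ) ∈ paramSpace d B :=
  (mem_paramSpace_iff hB.le).2 ⟨Matrix.PosDef.one.smul hB, by simpa using Matrix.PosSemidef.zero⟩

lemma conj_mem_paramSpace {B : ℝ} (hB : 0 ≤ B) {S : Matrix (Fin d) (Fin d) ℝ}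
    (hS : S ∈ paramSpace d B) {g : Matrix (Fin d) (Fin d) ℝ}
    (hg : g ∈ Matrix.orthogonalGroup (Fin d) ℝ) : g * S * gᵀ ∈ paramSpace d B := by
  rw [mem_paramSpace_iff hB] at hS ⊢
  refine ⟨posDef_conj hS.1 (isUnit_of_mem_orthogonal hg), ?_⟩
  have := posSemidef_conj hS.2 g
  rwa [Matrix.mul_sub, Matrix.sub_mul, Matrix.mul_smul, Matrix.smul_mul, Matrix.mul_one,
    orthogonal_mul_transpose hg] at this

/-- The entrywise expectation of a random matrix. -/
def meanMatrix (μ : Measure Ω) (P : Ω → Matrix (Fin d) (Fin d) ℝ) : Matrix (Fin d) (Fin d) ℝ :=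
  Matrix.of fun i j => ∫ ω, P ω i j ∂μ

lemma integral_trace_mul {μ : Measure Ω} {P : Ω → Matrix (Fin d) (Fin d) ℝ}
    (hP : ∀ i j, Integrable (fun ω => P ω i j) μ) (C : Matrix (Fin d) (Fin d) ℝ) :
    Integrable (fun ω => (P ω * C).trace) μ ∧
      ∫ ω, (P ω * C).trace ∂μ = (meanMatrix μ P * C).trace := by
  have h : ∀ M : Matrix (Fin d) (Fin d) ℝ, (M * C).trace = ∑ i, ∑ j, M i j * C j i := fun M => by
    simp [Matrix.trace, Matrix.mul_apply]
  simp only [h]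
  refine ⟨integrable_finsetSum _ fun i _ => integrable_finsetSum _ fun j _ =>
    (hP i j).mul_const _, ?_⟩
  rw [integral_finsetSum _ fun i _ => integrable_finsetSum _ fun j _ => (hP i j).mul_const _]
  refine Finset.sum_congr rfl fun i _ => ?_
  rw [integral_finsetSum _ fun j _ => (hP i j).mul_const _]
  exact Finset.sum_congr rfl fun j _ => integral_mul_const _ _

lemma posSemidef_meanMatrix_sub {μ : Measure Ω} [IsProbabilityMeasure μ]
    {P : Ω → Matrix (Fin d) (Fin d) ℝ} (hP : ∀ i j, Integrable (fun ω => P ω i j) μ) {c : ℝ}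
    (hc : ∀ ω, (P ω - c • (1 : Matrix (Fin d) (Fin d) ℝ)).PosSemidef) :
    (meanMatrix μ P - c • (1 : Matrix (Fin d) (Fin d) ℝ)).PosSemidef := by
  have hone : (c • (1 : Matrix (Fin d) (Fin d) ℝ)).IsHermitian := by
    rw [Matrix.IsHermitian, Matrix.conjTranspose_eq_transpose_of_trivial]; simp
  refine Matrix.PosSemidef.of_dotProduct_mulVec_nonneg ?_ fun x => ?_
  · refine Matrix.IsHermitian.sub ?_ hone
    ext i j
    simp only [Matrix.conjTranspose_apply, star_trivial, meanMatrix, Matrix.of_apply]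
    refine integral_congr_ae (.of_forall fun ω => ?_)
    have h1 : (P ω).IsHermitian := by simpa using (hc ω).isHermitian.add hone
    simpa using h1.apply i j
  -- A quadratic form is the trace pairing with `x xᵀ`, hence commutes with the mean.
  · have hquad : ∀ M : Matrix (Fin d) (Fin d) ℝ,
        star x ⬝ᵥ (M - c • (1 : Matrix (Fin d) (Fin d) ℝ)) *ᵥ x =
          (M * Matrix.vecMulVec x x).trace - c * (x ⬝ᵥ x) := fun M => by
      rw [Matrix.mul_vecMulVec, Matrix.trace_vecMulVec, dotProduct_comm (M *ᵥ x)]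
      simp [Matrix.sub_mulVec, Matrix.smul_mulVec]
    obtain ⟨hint, heq⟩ := integral_trace_mul hP (Matrix.vecMulVec x x)
    rw [hquad, ← heq]
    have : c * (x ⬝ᵥ x) = ∫ _, c * (x ⬝ᵥ x) ∂μ := by simp
    rw [this, ← integral_sub hint (integrable_const _)]
    refine integral_nonneg fun ω => ?_
    have h0 := (hc ω).dotProduct_mulVec_nonneg x
    rw [hquad] at h0
    exact h0

lemma posDef_of_sub_posSemidef {P : Matrix (Fin d) (Fin d) ℝ} {c : ℝ} (hc : 0 < c)
    (h : (P - c • (1 : Matrix (Fin d) (Fin d) ℝ)).PosSemidef) : P.PosDef := by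
  simpa using Matrix.PosDef.posSemidef_add h (Matrix.PosDef.one.smul hc)

/-- The estimate whose precision matrix is the mean of the precision matrices of the random
estimate `A`, or `B • 1` if this mean does not exist. -/
def averageEstimate (B : ℝ) (μ : Measure Ω) (A : Ω → Matrix (Fin d) (Fin d) ℝ) :
    Matrix (Fin d) (Fin d) ℝ :=
  open Classical in
  if ∀ i j, Integrable (fun ω => (A ω)⁻¹ i j) μ then (meanMatrix μ fun ω => (A ω)⁻¹)⁻¹
  else B • 1

variable {B : ℝ} {μ : Measure Ω} {A : Ω → Matrix (Fin d) (Fin d) ℝ}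

lemma averageEstimate_of_integrable (h : ∀ i j, Integrable (fun ω => (A ω)⁻¹ i j) μ) :
    averageEstimate B μ A = (meanMatrix μ fun ω => (A ω)⁻¹)⁻¹ := if_pos h

lemma averageEstimate_of_not_integrable (h : ¬∀ i j, Integrable (fun ω => (A ω)⁻¹ i j) μ) :
    averageEstimate B μ A = B • 1 := if_neg h

lemma posSemidef_meanMatrix_inv_sub [IsProbabilityMeasure μ] (hB : 0 < B)
    (hA : ∀ ω, A ω ∈ paramSpace d B) (h : ∀ i j, Integrable (fun ω => (A ω)⁻¹ i j) μ) :
    (meanMatrix μ (fun ω => (A ω)⁻¹) - B⁻¹ • (1 : Matrix (Fin d) (Fin d) ℝ)).PosSemidef :=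
  posSemidef_meanMatrix_sub h fun ω => ((mem_paramSpace_iff_inv hB).1 (hA ω)).2

lemma averageEstimate_mem [IsProbabilityMeasure μ] (hB : 0 < B)
    (hA : ∀ ω, A ω ∈ paramSpace d B) : averageEstimate B μ A ∈ paramSpace d B := by
  unfold averageEstimate
  split_ifs with h
  · have h1 := posSemidef_meanMatrix_inv_sub hB hA h
    have h2 := posDef_of_sub_posSemidef (inv_pos.2 hB) h1
    refine (mem_paramSpace_iff_inv hB).2 ⟨h2.inv, ?_⟩
    rwa [Matrix.nonsing_inv_nonsing_inv _ h2.det_pos.ne'.isUnit]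
  · exact smul_one_mem_paramSpace hB

/-- Finite expected loss forces the precision matrix to be integrable. -/
lemma integrable_inv_of_lintegral_entropyLoss [IsProbabilityMeasure μ]
    {S : Matrix (Fin d) (Fin d) ℝ} (hS : S.PosDef) (hmeas : Measurable A)
    (hA : ∀ ω, (A ω).PosDef)
    (h : ∫⁻ ω, ENNReal.ofReal (entropyLoss (A ω) S) ∂μ ≠ ∞) (i j : Fin d) :
    Integrable (fun ω => (A ω)⁻¹ i j) μ := by
  have hL : Integrable (fun ω => entropyLoss (A ω) S) μ :=
    ⟨((measurable_entropyLoss S).comp hmeas).aestronglyMeasurable, by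
      rw [hasFiniteIntegral_iff_ofReal (.of_forall fun ω => entropyLoss_nonneg (hA ω) hS)]
      exact h.lt_top⟩
  -- With `S = KᵀK`, the matrix `K A⁻¹ Kᵀ` is positive semidefinite with trace `tr(A⁻¹ S)`, so its
  -- entries are dominated by the loss; `K` is invertible, so this returns to `A⁻¹`.
  obtain ⟨K, hK⟩ := exists_eq_transpose_mul_self hS.posSemidef
  have hKu : IsUnit K := by
    have := hS.isUnit
    rw [hK, Matrix.isUnit_iff_isUnit_det, Matrix.det_mul] at this
    rw [Matrix.isUnit_iff_isUnit_det]
    exact isUnit_of_mul_isUnit_right this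
  have hinv' : Measurable fun ω => (A ω)⁻¹ := measurable_matrix_inv.comp hmeas
  have hW : ∀ k l, Integrable (fun ω => (K * (A ω)⁻¹ * Kᵀ) k l) μ := fun k l => by
    refine Integrable.mono' (g := fun ω => 2 * (entropyLoss (A ω) S + d * Real.log 2))
      ((hL.add (integrable_const _)).const_mul 2) ?_ (.of_forall fun ω => ?_)
    · exact (measurable_matrix_iff.1 ((hinv'.const_mul K).mul_const Kᵀ) k l).aestronglyMeasurable
    · refine (norm_entry_le_trace (posSemidef_conj (hA ω).inv.posSemidef K) k l).trans ?_
      rw [Matrix.trace_mul_comm, ← Matrix.mul_assoc, ← hK, Matrix.trace_mul_comm]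
      exact trace_le_entropyLoss (hA ω) hS
  have hdet : IsUnit K.det := (Matrix.isUnit_iff_isUnit_det K).1 hKu
  have hback : ∀ ω, (A ω)⁻¹ = K⁻¹ * (K * (A ω)⁻¹ * Kᵀ) * (Kᵀ)⁻¹ := fun ω => by
    rw [Matrix.mul_assoc, Matrix.mul_assoc, Matrix.mul_assoc,
      Matrix.mul_nonsing_inv _ (by rwa [Matrix.det_transpose]), Matrix.mul_one, ← Matrix.mul_assoc,
      Matrix.nonsing_inv_mul _ hdet, Matrix.one_mul]
  have hmul : ∀ M N R : Matrix (Fin d) (Fin d) ℝ,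
      (M * N * R) i j = ∑ l, (∑ k, M i k * N k l) * R l j := fun M N R => by
    simp only [Matrix.mul_apply]
  have hexp : ∀ ω, (A ω)⁻¹ i j =
      ∑ l, (∑ k, K⁻¹ i k * (K * (A ω)⁻¹ * Kᵀ) k l) * (Kᵀ)⁻¹ l j := fun ω =>
    (congrFun (congrFun (hback ω) i) j).trans (hmul _ _ _)
  simp only [hexp]
  exact integrable_finsetSum _ fun l _ => Integrable.mul_const
    (integrable_finsetSum _ fun k _ => (hW k l).const_mul _) _

/-- Jensen's inequality: averaging precision matrices does not increase the expected loss. -/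
lemma entropyLoss_averageEstimate_le [IsProbabilityMeasure μ] (hB : 0 < B)
    {S : Matrix (Fin d) (Fin d) ℝ} (hS : S.PosDef) (hmeas : Measurable A)
    (hA : ∀ ω, A ω ∈ paramSpace d B) :
    ENNReal.ofReal (entropyLoss (averageEstimate B μ A) S) ≤
      ∫⁻ ω, ENNReal.ofReal (entropyLoss (A ω) S) ∂μ := by
  by_cases hfin : ∫⁻ ω, ENNReal.ofReal (entropyLoss (A ω) S) ∂μ = ∞
  · rw [hfin]; exact le_top
  have hint := integrable_inv_of_lintegral_entropyLoss hS hmeas (fun ω => (hA ω).1) hfin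
  rw [averageEstimate, if_pos hint]
  set Q := meanMatrix μ fun ω => (A ω)⁻¹ with hQ
  have hQpos : Q.PosDef :=
    posDef_of_sub_posSemidef (inv_pos.2 hB) (posSemidef_meanMatrix_inv_sub hB hA hint)
  obtain ⟨h1, h2⟩ := integral_trace_mul hint (S - Q⁻¹)
  -- The tangent at the mean precision `Q`: its linear part integrates to zero.
  have htan : ∀ ω, entropyLoss Q⁻¹ S + (((A ω)⁻¹ * (S - Q⁻¹)).trace - (Q * (S - Q⁻¹)).trace) ≤
      entropyLoss (A ω) S := fun ω => by
    have := entropyLoss_tangent (hA ω).1.inv hQpos hS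
    rwa [Matrix.nonsing_inv_nonsing_inv _ (hA ω).1.det_pos.ne'.isUnit, Matrix.sub_mul,
      Matrix.trace_sub] at this
  have hmean : ∫ ω, (entropyLoss Q⁻¹ S +
      (((A ω)⁻¹ * (S - Q⁻¹)).trace - (Q * (S - Q⁻¹)).trace)) ∂μ = entropyLoss Q⁻¹ S := by
    have h3 := integral_add (integrable_const (entropyLoss Q⁻¹ S))
      (h1.sub (integrable_const (Q * (S - Q⁻¹)).trace))
    simp only [Pi.sub_apply] at h3
    rw [h3, integral_sub h1 (integrable_const _), h2]
    simp [hQ]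
  have hL : Integrable (fun ω => entropyLoss (A ω) S) μ :=
    ⟨((measurable_entropyLoss S).comp hmeas).aestronglyMeasurable, by
      rw [hasFiniteIntegral_iff_ofReal (.of_forall fun ω => entropyLoss_nonneg (hA ω).1 hS)]
      exact lt_top_iff_ne_top.2 hfin⟩
  rw [← hmean, ← ofReal_integral_eq_lintegral_ofReal hL
    (.of_forall fun ω => entropyLoss_nonneg (hA ω).1 hS)]
  exact ENNReal.ofReal_le_ofReal (integral_mono
    ((integrable_const _).add (h1.sub (integrable_const _))) hL htan)

/-- Conjugation commutes with the mean and preserves integrability in both directions, and the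
default `B • 1` is fixed by it. Equivariance therefore holds for all data, not just almost all. -/
lemma averageEstimate_conj {g : Matrix (Fin d) (Fin d) ℝ}
    (hg : g ∈ Matrix.orthogonalGroup (Fin d) ℝ) :
    averageEstimate B μ (fun ω => g * A ω * gᵀ) = g * averageEstimate B μ A * gᵀ := by
  have key : ∀ (C : Ω → Matrix (Fin d) (Fin d) ℝ) (h : Matrix (Fin d) (Fin d) ℝ),
      (∀ i j, Integrable (fun ω => C ω i j) μ) →
        (∀ i j, Integrable (fun ω => (h * C ω * hᵀ) i j) μ) ∧
        meanMatrix μ (fun ω => h * C ω * hᵀ) = h * meanMatrix μ C * hᵀ := by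
    intro C h hC
    have hexp : ∀ (M : Matrix (Fin d) (Fin d) ℝ) i j, (h * M * hᵀ) i j =
        (M * Matrix.vecMulVec (h j) (h i)).trace := fun M i j => by
      rw [Matrix.mul_vecMulVec, Matrix.trace_vecMulVec]
      simp only [Matrix.mul_apply, Matrix.transpose_apply, Matrix.mulVec, dotProduct,
        Finset.sum_mul]
      rw [Finset.sum_comm]
      refine Finset.sum_congr rfl fun k _ => Finset.sum_congr rfl fun l _ => by ring
    refine ⟨fun i j => ?_, ?_⟩
    · simp only [hexp]; exact (integral_trace_mul hC _).1
    · ext i j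
      rw [hexp, ← (integral_trace_mul hC _).2]
      simp only [meanMatrix, Matrix.of_apply, hexp]
  have hgt := transpose_mem_orthogonal hg
  have hback : ∀ M : Matrix (Fin d) (Fin d) ℝ, gᵀ * (g * M * gᵀ) * gᵀᵀ = M := fun M => by
    rw [Matrix.transpose_transpose, transpose_mul_conj_mul hg]
  have hinv : ∀ ω, (g * A ω * gᵀ)⁻¹ = g * (A ω)⁻¹ * gᵀ := fun ω => inv_conj_orthogonal hg _
  have hiff : (∀ i j, Integrable (fun ω => (g * A ω * gᵀ)⁻¹ i j) μ) ↔
      ∀ i j, Integrable (fun ω => (A ω)⁻¹ i j) μ := by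
    simp only [hinv]
    refine ⟨fun h => ?_, fun h => (key _ g h).1⟩
    have := (key _ gᵀ h).1
    simpa only [hback] using this
  by_cases h : ∀ i j, Integrable (fun ω => (A ω)⁻¹ i j) μ
  · rw [averageEstimate_of_integrable h, averageEstimate_of_integrable (hiff.2 h)]
    simp only [hinv]
    rw [(key _ g h).2, inv_conj_orthogonal hg]
  · rw [averageEstimate_of_not_integrable h,
      averageEstimate_of_not_integrable (fun h' => h (hiff.1 h')), Matrix.mul_smul,
      Matrix.smul_mul, Matrix.mul_one, orthogonal_mul_transpose hg]

lemma averageEstimate_comp {φ : Ω → Ω} (hφ : MeasurePreserving φ μ μ) (hmeas : Measurable A) :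
    averageEstimate B μ (fun ω => A (φ ω)) = averageEstimate B μ A := by
  have hm : ∀ i j, Measurable fun ω => (A ω)⁻¹ i j :=
    measurable_matrix_iff.1 (measurable_matrix_inv.comp hmeas)
  have h1 : ∀ i j, Integrable (fun ω => (A (φ ω))⁻¹ i j) μ ↔
      Integrable (fun ω => (A ω)⁻¹ i j) μ := fun i j =>
    hφ.integrable_comp (hm i j).aestronglyMeasurable
  have h2 : meanMatrix μ (fun ω => (A (φ ω))⁻¹) = meanMatrix μ fun ω => (A ω)⁻¹ := by
    ext i j
    simp only [meanMatrix, Matrix.of_apply]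
    conv_rhs => rw [← hφ.map_eq]
    rw [integral_map hφ.measurable.aemeasurable (hm i j).aestronglyMeasurable]
  by_cases h : ∀ i j, Integrable (fun ω => (A ω)⁻¹ i j) μ
  · rw [averageEstimate_of_integrable h,
      averageEstimate_of_integrable fun i j => (h1 i j).2 (h i j), h2]
  · rw [averageEstimate_of_not_integrable h,
      averageEstimate_of_not_integrable fun h' => h fun i j => (h1 i j).1 (h' i j)]

lemma measurable_averageEstimate {α : Type*} [MeasurableSpace α] [SFinite μ]
    {A : Ω → α → Matrix (Fin d) (Fin d) ℝ} (hA : Measurable fun p : Ω × α => A p.1 p.2) :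
    Measurable fun x => averageEstimate B μ fun ω => A ω x := by
  have hm : ∀ i j, Measurable fun p : α × Ω => (A p.2 p.1)⁻¹ i j :=
    measurable_matrix_iff.1 ((measurable_matrix_inv.comp hA).comp measurable_swap)
  unfold averageEstimate
  refine Measurable.ite ?_ (measurable_matrix_inv.comp (measurable_matrix_iff.2 fun i j => ?_))
    measurable_const
  · simp only [Set.ofPred_forall]
    exact MeasurableSet.iInter fun i => MeasurableSet.iInter fun j =>
      measurableSet_integrable (hm i j).stronglyMeasurable
  · exact ((hm i j).stronglyMeasurable.integral_prod_right').measurable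

end Average

/-! ### Symmetrization over the orthogonal groups -/

section Symmetrization

variable {n d : ℕ} {B : ℝ}

/-- A closed set of matrices with entries in `[-1, 1]`. Compactness makes the whole group available
as the set of Haar measure one. -/
instance : CompactSpace (Matrix.orthogonalGroup (Fin d) ℝ) := by
  have h1 : IsCompact (Set.univ.pi fun _ : Fin d => Set.univ.pi fun _ : Fin d =>
      Set.Icc (-1 : ℝ) 1) :=
    isCompact_univ_pi fun _ => isCompact_univ_pi fun _ => isCompact_Icc
  refine isCompact_iff_compactSpace.1 (IsCompact.of_isClosed_subset h1
    (isClosed_unitary (R := Matrix (Fin d) (Fin d) ℝ)) fun U hU => ?_)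
  intro i _ j _
  have := entry_norm_bound_of_unitary hU i j
  rwa [Real.norm_eq_abs, abs_le] at this

instance : BorelSpace (Matrix.orthogonalGroup (Fin d) ℝ) :=
  Subtype.borelSpace (Matrix.orthogonalGroup (Fin d) ℝ : Set (Matrix (Fin d) (Fin d) ℝ))

instance : SecondCountableTopology (Matrix.orthogonalGroup (Fin d) ℝ) :=
  TopologicalSpace.Subtype.secondCountableTopology
    (Matrix.orthogonalGroup (Fin d) ℝ : Set (Matrix (Fin d) (Fin d) ℝ))

/-- The group acting on the data: rotations of the observations and orthogonal mixings. -/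
abbrev SampleGroup (n d : ℕ) : Type :=
  Matrix.orthogonalGroup (Fin d) ℝ × Matrix.orthogonalGroup (Fin n) ℝ

/-- The Haar probability measure of `SampleGroup n d`. -/
def sampleHaar (n d : ℕ) : Measure (SampleGroup n d) := Measure.haarMeasure ⊤

instance : IsProbabilityMeasure (sampleHaar n d) :=
  ⟨by rw [sampleHaar]; simpa using Measure.haarMeasure_self (K₀ := (⊤ : TopologicalSpace.PositiveCompacts
    (SampleGroup n d)))⟩

instance : (sampleHaar n d).IsMulLeftInvariant := by
  unfold sampleHaar; infer_instance

lemma actSample_actSample (g h : Matrix (Fin d) (Fin d) ℝ) (X : Sample n d) :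
    actSample g (actSample h X) = actSample (g * h) X := by
  funext k; simp [actSample]

lemma mixSample_mixSample (o p : Matrix (Fin n) (Fin n) ℝ) (X : Sample n d) :
    mixSample o (mixSample p X) = mixSample (o * p) X := by
  funext k
  simp only [mixSample, Finset.smul_sum, Matrix.mul_apply, Finset.sum_smul, smul_smul]
  rw [Finset.sum_comm]

lemma mixSample_actSample (o : Matrix (Fin n) (Fin n) ℝ) (g : Matrix (Fin d) (Fin d) ℝ)
    (X : Sample n d) : mixSample o (actSample g X) = actSample g (mixSample o X) := by
  funext k
  simp only [mixSample, actSample, WithLp.ofLp_sum, WithLp.ofLp_smul, Matrix.mulVec_sum,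
    Matrix.mulVec_smul, WithLp.toLp_sum, WithLp.toLp_smul]

/-- An estimator that is equivariant under rotations and invariant under mixings of the
observations. -/
def Estimator.IsEquivariant (δ : Estimator n d B) : Prop :=
  (∀ g ∈ Matrix.orthogonalGroup (Fin d) ℝ, ∀ X, δ.est (actSample g X) = g * δ.est X * gᵀ) ∧
    ∀ o ∈ Matrix.orthogonalGroup (Fin n) ℝ, ∀ X, δ.est (mixSample o X) = δ.est X

/-- The estimate `g Σ̂(gᵀ X o) gᵀ`. -/
def conjugateEstimate (δ : Estimator n d B) (a : SampleGroup n d) (X : Sample n d) :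
    Matrix (Fin d) (Fin d) ℝ :=
  a.1.1 * δ.est (actSample a.1.1ᵀ (mixSample a.2.1ᵀ X)) * a.1.1ᵀ

/-- Rotating the data translates the group variable on the left, up to an outer conjugation; Haar
averaging removes the translation. -/
lemma conjugateEstimate_actSample (δ : Estimator n d B)
    (g : Matrix.orthogonalGroup (Fin d) ℝ) (a : SampleGroup n d) (X : Sample n d) :
    conjugateEstimate δ a (actSample g.1 X) =
      g.1 * conjugateEstimate δ ((g, 1)⁻¹ * a) X * g.1ᵀ := by
  have hinv : ((g⁻¹ * a.1 : Matrix.orthogonalGroup (Fin d) ℝ) : Matrix (Fin d) (Fin d) ℝ) =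
      g.1ᵀ * a.1.1 := by
    rw [Submonoid.coe_mul]
    congr 1
  simp only [conjugateEstimate, Prod.fst_mul, Prod.snd_mul, Prod.fst_inv, Prod.snd_inv, inv_one,
    one_mul, hinv, mixSample_actSample, actSample_actSample, Matrix.transpose_mul,
    Matrix.transpose_transpose]
  simp only [Matrix.mul_assoc, orthogonal_mul_transpose g.2, Matrix.mul_one]
  rw [← Matrix.mul_assoc g.1 g.1ᵀ, orthogonal_mul_transpose g.2, Matrix.one_mul]

lemma conjugateEstimate_mixSample (δ : Estimator n d B)
    (o : Matrix.orthogonalGroup (Fin n) ℝ) (a : SampleGroup n d) (X : Sample n d) :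
    conjugateEstimate δ a (mixSample o.1 X) = conjugateEstimate δ ((1, o)⁻¹ * a) X := by
  have hinv : ((o⁻¹ * a.2 : Matrix.orthogonalGroup (Fin n) ℝ) : Matrix (Fin n) (Fin n) ℝ) =
      o.1ᵀ * a.2.1 := by
    rw [Submonoid.coe_mul]
    congr 1
  simp only [conjugateEstimate, Prod.fst_mul, Prod.snd_mul, Prod.fst_inv, Prod.snd_inv, inv_one,
    one_mul, hinv, mixSample_mixSample, Matrix.transpose_mul, Matrix.transpose_transpose]

lemma conjugateEstimate_mem (hB : 0 ≤ B) (δ : Estimator n d B) (a : SampleGroup n d)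
    (X : Sample n d) : conjugateEstimate δ a X ∈ paramSpace d B :=
  conj_mem_paramSpace hB (δ.est_mem _) a.1.2

lemma continuous_groupAction :
    Continuous fun p : SampleGroup n d × Sample n d =>
      actSample p.1.1.1ᵀ (mixSample p.1.2.1ᵀ p.2) := by
  have h1 : Continuous fun p : SampleGroup n d × Sample n d => p.1.1.1 := by fun_prop
  have h2 : Continuous fun p : SampleGroup n d × Sample n d => p.1.2.1 := by fun_prop
  refine continuous_pi fun k => ?_
  refine (PiLp.continuous_toLp 2 _).comp ?_
  refine Continuous.matrix_mulVec h1.matrix_transpose ?_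
  refine (PiLp.continuous_ofLp 2 _).comp ?_
  refine continuous_finsetSum _ fun l _ => ?_
  exact (h2.matrix_elem l k).smul (by fun_prop)

/-- The loss is invariant under simultaneous conjugation, mixings preserve the law, and rotations
carry it to that of the rotated parameter. -/
lemma lintegral_entropyLoss_conjugateEstimate {S : Matrix (Fin d) (Fin d) ℝ} (hS : S.PosDef)
    (δ : Estimator n d B) (a : SampleGroup n d) :
    ∫⁻ X, ENNReal.ofReal (entropyLoss (conjugateEstimate δ a X) S) ∂(sampleLaw n S) =
      δ.risk (a.1.1ᵀ * S * a.1.1) := by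
  have ha := transpose_mem_orthogonal a.1.2
  have hloss : ∀ X, entropyLoss (conjugateEstimate δ a X) S =
      entropyLoss (δ.est (actSample a.1.1ᵀ (mixSample a.2.1ᵀ X))) (a.1.1ᵀ * S * a.1.1) :=
    fun X => by
      have h := entropyLoss_conj a.1.2 (δ.est (actSample a.1.1ᵀ (mixSample a.2.1ᵀ X)))
        (a.1.1ᵀ * S * a.1.1)
      rw [← h, conjugateEstimate]
      congr 1
      simp only [Matrix.mul_assoc, orthogonal_mul_transpose a.1.2, Matrix.mul_one]
      rw [← Matrix.mul_assoc, orthogonal_mul_transpose a.1.2, Matrix.one_mul]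
  simp only [hloss]
  have hmeas : Measurable fun Y : Sample n d =>
      ENNReal.ofReal (entropyLoss (δ.est Y) (a.1.1ᵀ * S * a.1.1)) :=
    ((measurable_entropyLoss _).comp δ.measurable).ennreal_ofReal
  have hlaw := map_actSample_sampleLaw (n := n) hS.posSemidef a.1.1ᵀ
  rw [Matrix.transpose_transpose] at hlaw
  rw [Estimator.risk, ← hlaw, lintegral_map hmeas (measurable_actSample _)]
  conv_rhs => rw [← map_mixSample_sampleLaw (transpose_mem_orthogonal a.2.2) S]
  exact (lintegral_map (hmeas.comp (measurable_actSample _)) (measurable_mixSample _)).symm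

lemma measurable_conjugateEstimate {C : Set (Estimator n d B)} (T : RandomizedEstimator C) :
    Measurable fun q : (T.Seed × SampleGroup n d) × Sample n d =>
      conjugateEstimate (T.draw q.1.1) q.1.2 q.2 := by
  have h1 : Measurable fun q : (T.Seed × SampleGroup n d) × Sample n d =>
      (T.draw q.1.1).est (actSample q.1.2.1.1ᵀ (mixSample q.1.2.2.1ᵀ q.2)) := by
    have h0 : Measurable fun p : T.Seed × Sample n d => (T.draw p.1).est p.2 :=
      measurable_matrix_iff.2 T.measurable_draw
    have h2 : Measurable fun q : (T.Seed × SampleGroup n d) × Sample n d =>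
        actSample q.1.2.1.1ᵀ (mixSample q.1.2.2.1ᵀ q.2) :=
      continuous_groupAction.measurable.comp
        ((measurable_snd.comp measurable_fst).prodMk measurable_snd)
    exact h0.comp ((measurable_fst.comp measurable_fst).prodMk h2)
  have h2 : Measurable fun q : (T.Seed × SampleGroup n d) × Sample n d => q.1.2.1.1 := by
    fun_prop
  have h3 : Measurable fun M : Matrix (Fin d) (Fin d) ℝ => Mᵀ :=
    (continuous_id.matrix_transpose).measurable
  exact (h2.mul h1).mul (h3.comp h2)

lemma measurable_conjugateEstimate_left {C : Set (Estimator n d B)} (T : RandomizedEstimator C)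
    (X : Sample n d) : Measurable fun p : T.Seed × SampleGroup n d =>
      conjugateEstimate (T.draw p.1) p.2 X := by
  have h1 : Measurable fun p : T.Seed × SampleGroup n d => (p, X) := measurable_prodMk_right
  have h2 := (measurable_conjugateEstimate T).comp h1
  exact h2

/-- The equivariant deterministic estimator obtained from a randomized estimator by averaging
precision matrices over the seed and over the group acting on the data. -/
def symmetrize {C : Set (Estimator n d B)} (hB : 0 < B) (T : RandomizedEstimator C) :
    Estimator n d B where
  est X := averageEstimate B (T.law.prod (sampleHaar n d))
    fun p => conjugateEstimate (T.draw p.1) p.2 X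
  measurable_est := measurable_matrix_iff.1
    (measurable_averageEstimate (measurable_conjugateEstimate T))
  est_mem _ := averageEstimate_mem hB fun _ => conjugateEstimate_mem hB.le _ _ _

lemma measurePreserving_prod_mul_left {α : Type*} [MeasurableSpace α] (ν : Measure α)
    [IsProbabilityMeasure ν] (b : SampleGroup n d) :
    MeasurePreserving (fun p : α × SampleGroup n d => (p.1, b * p.2))
      (ν.prod (sampleHaar n d)) (ν.prod (sampleHaar n d)) :=
  (MeasurePreserving.id ν).prod (measurePreserving_mul_left (sampleHaar n d) b)

lemma isEquivariant_symmetrize {C : Set (Estimator n d B)} (hB : 0 < B)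
    (T : RandomizedEstimator C) : (symmetrize hB T).IsEquivariant := by
  have hshift : ∀ (b : SampleGroup n d) (X : Sample n d),
      averageEstimate B (T.law.prod (sampleHaar n d))
        (fun p => conjugateEstimate (T.draw p.1) (b * p.2) X) = (symmetrize hB T).est X :=
    fun b X => averageEstimate_comp
      (A := fun p : T.Seed × SampleGroup n d => conjugateEstimate (T.draw p.1) p.2 X)
      (φ := fun p : T.Seed × SampleGroup n d => (p.1, b * p.2))
      (measurePreserving_prod_mul_left T.law b)
      (measurable_conjugateEstimate_left T X)
  refine ⟨fun g hg X => ?_, fun o ho X => ?_⟩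
  · rw [← hshift (⟨g, hg⟩, 1)⁻¹ X, ← averageEstimate_conj hg]
    exact congrArg (averageEstimate B _) (funext fun p =>
      conjugateEstimate_actSample (T.draw p.1) ⟨g, hg⟩ p.2 X)
  · rw [← hshift (1, ⟨o, ho⟩)⁻¹ X]
    exact congrArg (averageEstimate B _) (funext fun p =>
      conjugateEstimate_mixSample (T.draw p.1) ⟨o, ho⟩ p.2 X)

/-- Jensen's inequality for each fixed `X`, then Tonelli to integrate over the data first. -/
lemma risk_symmetrize_le {C : Set (Estimator n d B)} (hB : 0 < B) (T : RandomizedEstimator C)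
    {S : Matrix (Fin d) (Fin d) ℝ} (hS : S.PosDef) :
    (symmetrize hB T).risk S ≤ ∫⁻ a, T.risk (a.1.1ᵀ * S * a.1.1) ∂(sampleHaar n d) := by
  have hA := measurable_conjugateEstimate T
  have hmL : Measurable fun q : (T.Seed × SampleGroup n d) × Sample n d =>
      ENNReal.ofReal (entropyLoss (conjugateEstimate (T.draw q.1.1) q.1.2 q.2) S) :=
    ((measurable_entropyLoss S).comp hA).ennreal_ofReal
  have h1 : (symmetrize hB T).risk S ≤
      ∫⁻ X, ∫⁻ p, ENNReal.ofReal (entropyLoss (conjugateEstimate (T.draw p.1) p.2 X) S)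
          ∂(T.law.prod (sampleHaar n d)) ∂(sampleLaw n S) :=
    lintegral_mono fun X => entropyLoss_averageEstimate_le hB hS
      (measurable_conjugateEstimate_left T X)
      fun p => conjugateEstimate_mem hB.le _ _ _
  have h2 := lintegral_lintegral_swap (μ := sampleLaw n S)
    (ν := T.law.prod (sampleHaar n d))
    (f := fun X p => ENNReal.ofReal (entropyLoss (conjugateEstimate (T.draw p.1) p.2 X) S))
    (hmL.comp measurable_swap).aemeasurable
  have h3 := lintegral_prod_symm (μ := T.law) (ν := sampleHaar n d) _
    (hmL.lintegral_prod_right' (ν := sampleLaw n S)).aemeasurable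
  refine (h1.trans_eq h2).trans_eq (h3.trans ?_)
  exact lintegral_congr fun a => lintegral_congr fun ω =>
    lintegral_entropyLoss_conjugateEstimate hS (T.draw ω) a

/-- Every randomized estimator is dominated by an equivariant deterministic one. -/
lemma exists_equivariant_risk_le {C : Set (Estimator n d B)} (hB : 0 < B)
    (T : RandomizedEstimator C) : ∃ δ : Estimator n d B, δ.IsEquivariant ∧
      ⨆ S ∈ paramSpace d B, δ.risk S ≤ ⨆ S ∈ paramSpace d B, T.risk S := by
  refine ⟨symmetrize hB T, isEquivariant_symmetrize hB T, iSup₂_le fun S hS => ?_⟩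
  refine (risk_symmetrize_le hB T hS.1).trans ?_
  calc _ ≤ ∫⁻ _, ⨆ S ∈ paramSpace d B, T.risk S ∂(sampleHaar n d) := by
        refine lintegral_mono fun a => ?_
        have h := conj_mem_paramSpace hB.le hS (transpose_mem_orthogonal a.1.2)
        rw [Matrix.transpose_transpose] at h
        exact le_iSup₂ (f := fun S (_ : S ∈ paramSpace d B) => T.risk S) _ h
    _ = ⨆ S ∈ paramSpace d B, T.risk S := by simp

end Symmetrization

/-! ### Harmonic means -/

section HarmonicMean

variable {n d : ℕ} {B : ℝ}

/-- The harmonic mean of two matrices. -/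
def harmonicMean (A C : Matrix (Fin d) (Fin d) ℝ) : Matrix (Fin d) (Fin d) ℝ :=
  ((2 : ℝ)⁻¹ • (A⁻¹ + C⁻¹))⁻¹

lemma posDef_half_add {P Q : Matrix (Fin d) (Fin d) ℝ} (hP : P.PosDef) (hQ : Q.PosDef) :
    ((2 : ℝ)⁻¹ • (P + Q)).PosDef := (hP.add hQ).smul (by norm_num)

lemma harmonicMean_mem (hB : 0 < B) {A C : Matrix (Fin d) (Fin d) ℝ}
    (hA : A ∈ paramSpace d B) (hC : C ∈ paramSpace d B) : harmonicMean A C ∈ paramSpace d B := by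
  have hQ := posDef_half_add hA.1.inv hC.1.inv
  rw [mem_paramSpace_iff_inv hB] at hA hC ⊢
  refine ⟨hQ.inv, ?_⟩
  rw [harmonicMean, Matrix.nonsing_inv_nonsing_inv _ hQ.det_pos.ne'.isUnit]
  have h := (hA.2.add hC.2).smul (α := ℝ) (a := (2 : ℝ)⁻¹) (by norm_num)
  convert h using 1
  module

/-- Add the two tangent inequalities at the midpoint of the precisions; the linear terms cancel. -/
lemma two_mul_entropyLoss_harmonicMean_le {A C S : Matrix (Fin d) (Fin d) ℝ} (hA : A.PosDef)
    (hC : C.PosDef) (hS : S.PosDef) :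
    2 * entropyLoss (harmonicMean A C) S ≤ entropyLoss A S + entropyLoss C S := by
  have hQ := posDef_half_add hA.inv hC.inv
  have h1 := entropyLoss_tangent hA.inv hQ hS
  have h2 := entropyLoss_tangent hC.inv hQ hS
  rw [Matrix.nonsing_inv_nonsing_inv _ hA.det_pos.ne'.isUnit] at h1
  rw [Matrix.nonsing_inv_nonsing_inv _ hC.det_pos.ne'.isUnit] at h2
  have h3 : (A⁻¹ - (2 : ℝ)⁻¹ • (A⁻¹ + C⁻¹)) + (C⁻¹ - (2 : ℝ)⁻¹ • (A⁻¹ + C⁻¹)) = 0 := by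
    module
  have h4 := congrArg (fun M => (M * (S - ((2 : ℝ)⁻¹ • (A⁻¹ + C⁻¹))⁻¹)).trace) h3
  simp only [Matrix.add_mul, Matrix.trace_add, Matrix.zero_mul, Matrix.trace_zero] at h4
  rw [harmonicMean]
  linarith

/-- The gap between the arithmetic and the harmonic mean. -/
lemma sub_mul_inv_add_mul_sub {A C : Matrix (Fin d) (Fin d) ℝ} (hA : A.PosDef) (hC : C.PosDef) :
    (A - C) * (A + C)⁻¹ * (A - C) = A + C - (2 : ℝ) • harmonicMean A C := by
  have hs : (A + C).PosDef := hA.add hC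
  have h1 : (A + C) * (A + C)⁻¹ = 1 := Matrix.mul_nonsing_inv _ hs.det_pos.ne'.isUnit
  have h2 : (A + C)⁻¹ * (A + C) = 1 := Matrix.nonsing_inv_mul _ hs.det_pos.ne'.isUnit
  have hAi : A⁻¹ * A = 1 := Matrix.nonsing_inv_mul _ hA.det_pos.ne'.isUnit
  have hCi : C * C⁻¹ = 1 := Matrix.mul_nonsing_inv _ hC.det_pos.ne'.isUnit
  have hCi' : C⁻¹ * C = 1 := Matrix.nonsing_inv_mul _ hC.det_pos.ne'.isUnit
  -- The parallel-sum formula. Writing the left factor as `2A - (A + C)` and the right one as `(A +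
  -- C) - 2C` then makes the product expand to the gap.
  have hH : harmonicMean A C = (2 : ℝ) • (A * (A + C)⁻¹ * C) := by
    refine Matrix.inv_eq_right_inv ?_
    rw [Matrix.smul_mul, Matrix.mul_smul, smul_smul, inv_mul_cancel₀ two_ne_zero, one_smul]
    have h3 : (A⁻¹ + C⁻¹) * A = C⁻¹ * (A + C) := by
      rw [Matrix.add_mul, Matrix.mul_add, hAi, hCi', add_comm]
    rw [Matrix.mul_assoc, ← Matrix.mul_assoc, h3, Matrix.mul_assoc, ← Matrix.mul_assoc (A + C),
      h1, Matrix.one_mul, hCi']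
  have e1 : A - C = (2 : ℝ) • A - (A + C) := by module
  have e2 : A - C = (A + C) - (2 : ℝ) • C := by module
  rw [hH]
  calc (A - C) * (A + C)⁻¹ * (A - C)
      = ((2 : ℝ) • A - (A + C)) * (A + C)⁻¹ * ((A + C) - (2 : ℝ) • C) := by rw [← e1, ← e2]
    _ = _ := by
      rw [Matrix.sub_mul, h1, Matrix.sub_mul, Matrix.mul_sub, Matrix.mul_assoc, h2]
      simp only [Matrix.smul_mul, Matrix.mul_smul, Matrix.mul_one, Matrix.one_mul]
      module

/-- Quantitative strict concavity: `‖A + C‖ ≤ 2B` gives `(A + C)⁻¹ ≥ (2B)⁻¹`, so the gap `(A - C)(A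
+ C)⁻¹(A - C)` has trace at least `(2B)⁻¹` times the squared Frobenius distance. -/
lemma sum_sq_sub_le_trace (hB : 0 < B) {A C : Matrix (Fin d) (Fin d) ℝ}
    (hA : A ∈ paramSpace d B) (hC : C ∈ paramSpace d B) :
    ∑ i, ∑ j, (A i j - C i j) ^ 2 ≤
      2 * B * (A.trace + C.trace - 2 * (harmonicMean A C).trace) := by
  have hgap := congrArg Matrix.trace (sub_mul_inv_add_mul_sub hA.1 hC.1)
  rw [Matrix.trace_sub, Matrix.trace_add, Matrix.trace_smul, smul_eq_mul] at hgap
  have hs : A + C ∈ paramSpace d (2 * B) := by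
    rw [mem_paramSpace_iff hB.le] at hA hC
    rw [mem_paramSpace_iff (by positivity)]
    refine ⟨hA.1.add hC.1, ?_⟩
    convert hA.2.add hC.2 using 1
    module
  have hs' := ((mem_paramSpace_iff_inv (by positivity)).1 hs).2
  have hsymm : (A - C)ᵀ = A - C := by
    simpa [Matrix.IsHermitian, Matrix.conjTranspose_eq_transpose_of_trivial] using
      hA.1.isHermitian.sub hC.1.isHermitian
  have h := (posSemidef_conj hs' (A - C)).trace_nonneg
  rw [hsymm, Matrix.mul_sub (A - C) (A + C)⁻¹, Matrix.sub_mul ((A - C) * (A + C)⁻¹),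
    Matrix.trace_sub, hgap] at h
  have htr : ((A - C) * (2 * B)⁻¹ • (1 : Matrix (Fin d) (Fin d) ℝ) * (A - C)).trace =
      (2 * B)⁻¹ * ∑ i, ∑ j, (A i j - C i j) ^ 2 := by
    rw [Matrix.mul_smul, Matrix.smul_mul, Matrix.trace_smul, Matrix.mul_one, smul_eq_mul]
    congr 1
    have h0 : (A - C) * (A - C) = (A - C)ᵀ * (A - C) := by rw [hsymm]
    rw [h0]
    simp only [Matrix.trace, Matrix.diag_apply, Matrix.mul_apply, Matrix.transpose_apply,
      Matrix.sub_apply, sq]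
    rw [Finset.sum_comm]
  rw [htr] at h
  have h' : (2 * B)⁻¹ * ∑ i, ∑ j, (A i j - C i j) ^ 2 ≤
      A.trace + C.trace - 2 * (harmonicMean A C).trace := by linarith
  rwa [inv_mul_le_iff₀ (by positivity)] at h'

lemma trace_mem_Icc (hB : 0 < B) {A : Matrix (Fin d) (Fin d) ℝ} (hA : A ∈ paramSpace d B) :
    0 ≤ A.trace ∧ A.trace ≤ B * d := by
  rw [mem_paramSpace_iff hB.le] at hA
  refine ⟨hA.1.posSemidef.trace_nonneg, ?_⟩
  have := hA.2.trace_nonneg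
  simpa [Matrix.trace_sub, Matrix.trace_smul, Matrix.trace_one] using this

/-- The estimator that takes the harmonic mean of two estimates. -/
def Estimator.harmonicMean (hB : 0 < B) (δ η : Estimator n d B) : Estimator n d B where
  est X := CovarianceGame.harmonicMean (δ.est X) (η.est X)
  measurable_est := measurable_matrix_iff.1 <| measurable_matrix_inv.comp <|
    ((measurable_matrix_inv.comp δ.measurable).add
      (measurable_matrix_inv.comp η.measurable)).const_smul (2 : ℝ)⁻¹
  est_mem X := harmonicMean_mem hB (δ.est_mem X) (η.est_mem X)

lemma Estimator.IsEquivariant.harmonicMean (hB : 0 < B) {δ η : Estimator n d B}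
    (hδ : δ.IsEquivariant) (hη : η.IsEquivariant) : (δ.harmonicMean hB η).IsEquivariant := by
  refine ⟨fun g hg X => ?_, fun o ho X => ?_⟩
  · simp only [Estimator.harmonicMean, CovarianceGame.harmonicMean, hδ.1 g hg, hη.1 g hg,
      inv_conj_orthogonal hg]
    refine Eq.trans (congrArg _ ?_) (inv_conj_orthogonal hg _)
    rw [Matrix.mul_smul, Matrix.smul_mul, Matrix.mul_add, Matrix.add_mul]
  · simp only [Estimator.harmonicMean, hδ.2 o ho, hη.2 o ho]

lemma Estimator.risk_harmonicMean_le (hB : 0 < B) {δ η : Estimator n d B}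
    {S : Matrix (Fin d) (Fin d) ℝ} (hS : S.PosDef) {c : ℝ≥0∞} (h1 : δ.risk S ≤ c)
    (h2 : η.risk S ≤ c) : (δ.harmonicMean hB η).risk S ≤ c := by
  have hm : ∀ ζ : Estimator n d B, Measurable fun X => ENNReal.ofReal (entropyLoss (ζ.est X) S) :=
    fun ζ => ((measurable_entropyLoss _).comp ζ.measurable).ennreal_ofReal
  have h : 2 * (δ.harmonicMean hB η).risk S ≤ 2 * c := by
    calc 2 * (δ.harmonicMean hB η).risk S
        = ∫⁻ X, 2 * ENNReal.ofReal (entropyLoss ((δ.harmonicMean hB η).est X) S)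
            ∂(sampleLaw n S) := (lintegral_const_mul _ (hm _)).symm
      _ ≤ ∫⁻ X, (ENNReal.ofReal (entropyLoss (δ.est X) S) +
            ENNReal.ofReal (entropyLoss (η.est X) S)) ∂(sampleLaw n S) := by
          refine lintegral_mono fun X => ?_
          rw [← ENNReal.ofReal_add (entropyLoss_nonneg (δ.est_mem X).1 hS)
            (entropyLoss_nonneg (η.est_mem X).1 hS)]
          rw [show (2 : ℝ≥0∞) = ENNReal.ofReal 2 by simp, ← ENNReal.ofReal_mul (by norm_num)]
          exact ENNReal.ofReal_le_ofReal
            (two_mul_entropyLoss_harmonicMean_le (δ.est_mem X).1 (η.est_mem X).1 hS)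
      _ = δ.risk S + η.risk S := lintegral_add_left (hm _) _
      _ ≤ 2 * c := by rw [two_mul]; exact add_le_add h1 h2
  exact (ENNReal.mul_le_mul_iff_right two_ne_zero ENNReal.ofNat_ne_top).1 h

end HarmonicMean

/-! ### The size of an estimator -/

section MeanTrace

variable {n d : ℕ} {B : ℝ}

/-- The expected trace of an estimator under the standard normal law. -/
def Estimator.meanTrace (δ : Estimator n d B) : ℝ :=
  ∫ X, (δ.est X).trace ∂(sampleLaw n (1 : Matrix (Fin d) (Fin d) ℝ))

lemma Estimator.integrable_trace (hB : 0 < B) (δ : Estimator n d B) :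
    Integrable (fun X => (δ.est X).trace) (sampleLaw n (1 : Matrix (Fin d) (Fin d) ℝ)) := by
  have hm : Measurable fun X => (δ.est X).trace :=
    (continuous_id.matrix_trace).measurable.comp δ.measurable
  refine Integrable.of_bound hm.aestronglyMeasurable (B * d) (.of_forall fun X => ?_)
  have := trace_mem_Icc hB (δ.est_mem X)
  rw [Real.norm_eq_abs, abs_of_nonneg this.1]
  exact this.2

lemma Estimator.meanTrace_mem_Icc (hB : 0 < B) (δ : Estimator n d B) :
    0 ≤ δ.meanTrace ∧ δ.meanTrace ≤ B * d := by
  refine ⟨integral_nonneg fun X => (trace_mem_Icc hB (δ.est_mem X)).1, ?_⟩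
  have h := integral_mono (δ.integrable_trace hB)
    (integrable_const (μ := sampleLaw n (1 : Matrix (Fin d) (Fin d) ℝ)) (B * d))
    fun X => (trace_mem_Icc hB (δ.est_mem X)).2
  simpa [Estimator.meanTrace] using h

/-- The integrated form of `sum_sq_sub_le_trace`: if the harmonic mean hardly lowers the expected
trace, the two estimators are close in `L²`. -/
lemma Estimator.eLpNorm_sub_le (hB : 0 < B) (δ η : Estimator n d B) (i j : Fin d) {c : ℝ}
    (hc : 0 ≤ c)
    (h : 2 * B * (δ.meanTrace + η.meanTrace - 2 * (δ.harmonicMean hB η).meanTrace) ≤ c ^ 2) :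
    eLpNorm ((fun X => δ.est X i j) - fun X => η.est X i j) 2
      (sampleLaw n (1 : Matrix (Fin d) (Fin d) ℝ)) ≤ ENNReal.ofReal c := by
  set μ := sampleLaw n (1 : Matrix (Fin d) (Fin d) ℝ)
  have hint : Integrable (fun X => 2 * B * ((δ.est X).trace + (η.est X).trace -
      2 * ((δ.harmonicMean hB η).est X).trace)) μ := (((δ.integrable_trace hB).add (η.integrable_trace hB)).sub
    (((δ.harmonicMean hB η).integrable_trace hB).const_mul 2)).const_mul (2 * B)
  have hle : ∫⁻ X, ‖δ.est X i j - η.est X i j‖ₑ ^ (2 : ℝ) ∂μ ≤ ENNReal.ofReal (c ^ 2) := by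
    calc ∫⁻ X, ‖δ.est X i j - η.est X i j‖ₑ ^ (2 : ℝ) ∂μ
        ≤ ∫⁻ X, ENNReal.ofReal (2 * B * ((δ.est X).trace + (η.est X).trace -
            2 * ((δ.harmonicMean hB η).est X).trace)) ∂μ := by
          refine lintegral_mono fun X => ?_
          rw [← ofReal_norm, ENNReal.ofReal_rpow_of_nonneg (norm_nonneg _) (by norm_num)]
          refine ENNReal.ofReal_le_ofReal ?_
          rw [Real.rpow_two, Real.norm_eq_abs, sq_abs]
          refine le_trans ?_ (sum_sq_sub_le_trace hB (δ.est_mem X) (η.est_mem X))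
          refine le_trans ?_ (Finset.single_le_sum
            (f := fun i => ∑ j, (δ.est X i j - η.est X i j) ^ 2)
            (fun i _ => Finset.sum_nonneg fun j _ => sq_nonneg _) (Finset.mem_univ i))
          exact Finset.single_le_sum (f := fun j => (δ.est X i j - η.est X i j) ^ 2)
            (fun j _ => sq_nonneg _) (Finset.mem_univ j)
      _ = ENNReal.ofReal (2 * B * (δ.meanTrace + η.meanTrace -
            2 * (δ.harmonicMean hB η).meanTrace)) := by
          rw [← ofReal_integral_eq_lintegral_ofReal hint]
          · congr 1
            rw [integral_const_mul]
            congr 1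
            have h1 := integral_sub ((δ.integrable_trace hB).add (η.integrable_trace hB))
              (((δ.harmonicMean hB η).integrable_trace hB).const_mul 2)
            have h2 := integral_add (δ.integrable_trace hB) (η.integrable_trace hB)
            simp only [Pi.add_apply] at h1
            rw [h1, h2, integral_const_mul]
            rfl
          · refine .of_forall fun X => ?_
            exact le_trans (Finset.sum_nonneg fun i _ => Finset.sum_nonneg fun j _ => sq_nonneg _)
              (sum_sq_sub_le_trace hB (δ.est_mem X) (η.est_mem X))
      _ ≤ ENNReal.ofReal (c ^ 2) := ENNReal.ofReal_le_ofReal h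
  rw [eLpNorm_eq_lintegral_rpow_enorm_toReal two_ne_zero ENNReal.ofNat_ne_top]
  simp only [ENNReal.toReal_ofNat, Pi.sub_apply]
  calc _ ≤ (ENNReal.ofReal (c ^ 2)) ^ (1 / (2 : ℝ)) := by gcongr
    _ = ENNReal.ofReal c := by
      rw [ENNReal.ofReal_rpow_of_nonneg (by positivity) (by norm_num), ← Real.sqrt_eq_rpow,
        Real.sqrt_sq hc]

end MeanTrace

/-! ### Limits of estimators -/

section Limit

open Filter Topology

variable {n d : ℕ} {B : ℝ}

/-- The limit of a sequence of estimates if it exists and is invertible, and `B • 1` otherwise. -/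
def limitEstimate (B : ℝ) (A : ℕ → Matrix (Fin d) (Fin d) ℝ) : Matrix (Fin d) (Fin d) ℝ :=
  open Classical in
  if h : ∃ M, Tendsto A atTop (𝓝 M) ∧ M.det ≠ 0 then h.choose else B • 1

lemma limitEstimate_of_tendsto {A : ℕ → Matrix (Fin d) (Fin d) ℝ} {M : Matrix (Fin d) (Fin d) ℝ}
    (hM : Tendsto A atTop (𝓝 M)) (hdet : M.det ≠ 0) : limitEstimate B A = M := by
  have h : ∃ M, Tendsto A atTop (𝓝 M) ∧ M.det ≠ 0 := ⟨M, hM, hdet⟩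
  rw [limitEstimate, dif_pos h]
  exact tendsto_nhds_unique h.choose_spec.1 hM

lemma limitEstimate_of_not {A : ℕ → Matrix (Fin d) (Fin d) ℝ}
    (h : ¬∃ M, Tendsto A atTop (𝓝 M) ∧ M.det ≠ 0) : limitEstimate B A = B • 1 :=
  dif_neg h

lemma tendsto_matrix_iff {A : ℕ → Matrix (Fin d) (Fin d) ℝ} {M : Matrix (Fin d) (Fin d) ℝ} :
    Tendsto A atTop (𝓝 M) ↔ ∀ i j, Tendsto (fun k => A k i j) atTop (𝓝 (M i j)) := by
  refine Iff.trans (tendsto_pi_nhds (f := fun k i => A k i)) ?_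
  exact forall_congr' fun i => tendsto_pi_nhds

lemma isClosed_posSemidef : IsClosed {M : Matrix (Fin d) (Fin d) ℝ | M.PosSemidef} := by
  have h : {M : Matrix (Fin d) (Fin d) ℝ | M.PosSemidef} =
      {M | Mᵀ = M} ∩ ⋂ x : Fin d → ℝ, {M | 0 ≤ x ⬝ᵥ M *ᵥ x} := by
    ext M
    simp [Matrix.posSemidef_iff_dotProduct_mulVec, Matrix.IsHermitian,
      Matrix.conjTranspose_eq_transpose_of_trivial]
  rw [h]
  refine (isClosed_eq (continuous_id.matrix_transpose) continuous_id).inter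
    (isClosed_iInter fun x => isClosed_le continuous_const ?_)
  exact Continuous.dotProduct continuous_const (continuous_id.matrix_mulVec continuous_const)

/-- Both Loewner conditions are closed, so only invertibility can be lost in the limit. -/
lemma mem_paramSpace_of_tendsto (hB : 0 < B) {A : ℕ → Matrix (Fin d) (Fin d) ℝ}
    {M : Matrix (Fin d) (Fin d) ℝ} (hA : ∀ k, A k ∈ paramSpace d B)
    (hM : Tendsto A atTop (𝓝 M)) (hdet : M.det ≠ 0) : M ∈ paramSpace d B := by
  have hA' := fun k => (mem_paramSpace_iff hB.le).1 (hA k)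
  rw [mem_paramSpace_iff hB.le]
  have h1 : M.PosSemidef :=
    isClosed_posSemidef.mem_of_tendsto hM (.of_forall fun k => (hA' k).1.posSemidef)
  exact ⟨h1.posDef_iff_det_ne_zero.2 hdet, isClosed_posSemidef.mem_of_tendsto
    (tendsto_const_nhds.sub hM) (.of_forall fun k => (hA' k).2)⟩

lemma limitEstimate_mem (hB : 0 < B) {A : ℕ → Matrix (Fin d) (Fin d) ℝ}
    (hA : ∀ k, A k ∈ paramSpace d B) : limitEstimate B A ∈ paramSpace d B := by
  by_cases h : ∃ M, Tendsto A atTop (𝓝 M) ∧ M.det ≠ 0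
  · obtain ⟨M, hM, hdet⟩ := h
    rw [limitEstimate_of_tendsto hM hdet]
    exact mem_paramSpace_of_tendsto hB hA hM hdet
  · rw [limitEstimate_of_not h]
    exact smul_one_mem_paramSpace hB

lemma measurable_limitEstimate {α : Type*} [MeasurableSpace α]
    {A : ℕ → α → Matrix (Fin d) (Fin d) ℝ} (hA : ∀ k, Measurable (A k)) :
    Measurable fun x => limitEstimate B fun k => A k x := by
  classical
  have hm : ∀ i j k, Measurable fun x => A k x i j := fun i j k =>
    measurable_matrix_iff.1 (hA k) i j
  let L : α → Matrix (Fin d) (Fin d) ℝ := fun x i j => limUnder atTop fun k => A k x i j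
  have hL : Measurable L := measurable_matrix_iff.2 fun i j =>
    (StronglyMeasurable.limUnder fun k => (hm i j k).stronglyMeasurable).measurable
  let E : Set α := {x | ∀ i j, ∃ c, Tendsto (fun k => A k x i j) atTop (𝓝 c)} ∩
    {x | (L x).det ≠ 0}
  have hE : MeasurableSet E := by
    refine MeasurableSet.inter ?_ ?_
    · simp only [Set.ofPred_forall]
      exact MeasurableSet.iInter fun i => MeasurableSet.iInter fun j =>
        measurableSet_exists_tendsto (hm i j)
    · exact (((continuous_id.matrix_det).measurable.comp hL)
        (measurableSet_singleton (0 : ℝ))).compl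
  have htend : ∀ x, (∀ i j, ∃ c, Tendsto (fun k => A k x i j) atTop (𝓝 c)) →
      Tendsto (fun k => A k x) atTop (𝓝 (L x)) := fun x hx =>
    tendsto_matrix_iff.2 fun i j => tendsto_nhds_limUnder (hx i j)
  have heq : (fun x => limitEstimate B fun k => A k x) =
      fun x => if x ∈ E then L x else B • 1 := by
    funext x
    split_ifs with hx
    · exact limitEstimate_of_tendsto (htend x hx.1) hx.2
    · refine limitEstimate_of_not fun ⟨M, hM, hdet⟩ => hx ?_
      have h1 : ∀ i j, ∃ c, Tendsto (fun k => A k x i j) atTop (𝓝 c) := fun i j =>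
        ⟨M i j, tendsto_matrix_iff.1 hM i j⟩
      refine ⟨h1, ?_⟩
      rwa [tendsto_nhds_unique hM (htend x h1)] at hdet
  rw [heq]
  exact Measurable.ite hE hL measurable_const

/-- Convergence to an invertible limit is unaffected by conjugation and the default is fixed, so
equivariance survives even where the sequence diverges. -/
lemma limitEstimate_conj {g : Matrix (Fin d) (Fin d) ℝ}
    (hg : g ∈ Matrix.orthogonalGroup (Fin d) ℝ) (A : ℕ → Matrix (Fin d) (Fin d) ℝ) :
    limitEstimate B (fun k => g * A k * gᵀ) = g * limitEstimate B A * gᵀ := by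
  have key : ∀ (C : ℕ → Matrix (Fin d) (Fin d) ℝ) (M h : Matrix (Fin d) (Fin d) ℝ),
      h ∈ Matrix.orthogonalGroup (Fin d) ℝ → Tendsto C atTop (𝓝 M) ∧ M.det ≠ 0 →
        Tendsto (fun k => h * C k * hᵀ) atTop (𝓝 (h * M * hᵀ)) ∧ (h * M * hᵀ).det ≠ 0 := by
    rintro C M h hh ⟨hC, hM⟩
    refine ⟨(tendsto_const_nhds.mul hC).mul tendsto_const_nhds, ?_⟩
    have hu := (Matrix.isUnit_iff_isUnit_det h).1 (isUnit_of_mem_orthogonal hh)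
    simp [Matrix.det_mul, hu.ne_zero, hM]
  by_cases h : ∃ M, Tendsto A atTop (𝓝 M) ∧ M.det ≠ 0
  · obtain ⟨M, hM⟩ := h
    have := key A M g hg hM
    rw [limitEstimate_of_tendsto hM.1 hM.2, limitEstimate_of_tendsto this.1 this.2]
  · rw [limitEstimate_of_not h, limitEstimate_of_not, Matrix.mul_smul, Matrix.smul_mul,
      Matrix.mul_one, orthogonal_mul_transpose hg]
    rintro ⟨M, hM⟩
    refine h ⟨gᵀ * M * gᵀᵀ, ?_⟩
    have := key _ M gᵀ (transpose_mem_orthogonal hg) hM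
    have hback : ∀ N : Matrix (Fin d) (Fin d) ℝ, gᵀ * (g * N * gᵀ) * gᵀᵀ = N := fun N => by
      rw [Matrix.transpose_transpose, transpose_mul_conj_mul hg]
    simp only [hback] at this
    exact this

/-- The estimator `limitEstimate` computed from a sequence of estimators. -/
def limitEstimator (hB : 0 < B) (δ : ℕ → Estimator n d B) : Estimator n d B where
  est X := limitEstimate B fun k => (δ k).est X
  measurable_est := measurable_matrix_iff.1 (measurable_limitEstimate fun k => (δ k).measurable)
  est_mem X := limitEstimate_mem hB fun k => (δ k).est_mem X

lemma isEquivariant_limitEstimator (hB : 0 < B) {δ : ℕ → Estimator n d B}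
    (hδ : ∀ k, (δ k).IsEquivariant) : (limitEstimator hB δ).IsEquivariant := by
  refine ⟨fun g hg X => ?_, fun o ho X => ?_⟩
  · simp only [limitEstimator, (hδ _).1 g hg]
    exact limitEstimate_conj hg _
  · simp only [limitEstimator, (hδ _).2 o ho]

lemma tendsto_entropyLoss {A : ℕ → Matrix (Fin d) (Fin d) ℝ} {M S : Matrix (Fin d) (Fin d) ℝ}
    (hA : ∀ k, (A k).PosDef) (hM : M.PosDef) (hS : S.PosDef) (h : Tendsto A atTop (𝓝 M)) :
    Tendsto (fun k => entropyLoss (A k) S) atTop (𝓝 (entropyLoss M S)) := by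
  have hdet : Tendsto (fun k => (A k).det) atTop (𝓝 M.det) :=
    ((continuous_id.matrix_det).tendsto M).comp h
  have hinv : Tendsto (fun k => (A k)⁻¹) atTop (𝓝 M⁻¹) := by
    simp only [Matrix.inv_def, Ring.inverse_eq_inv']
    exact (hdet.inv₀ hM.det_pos.ne').smul (((continuous_id.matrix_adjugate).tendsto M).comp h)
  have htr : Tendsto (fun k => ((A k)⁻¹ * S).trace) atTop (𝓝 (M⁻¹ * S).trace) :=
    ((continuous_id.matrix_trace).tendsto _).comp (hinv.mul_const S)
  simp only [entropyLoss_eq (hA _) hS, entropyLoss_eq hM hS]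
  exact ((htr.add (hdet.log hM.det_pos.ne')).sub_const _).sub_const _

/-- Lower semicontinuity of the loss along convergent estimates. -/
lemma entropyLoss_limitEstimate_le_liminf (hB : 0 < B) {A : ℕ → Matrix (Fin d) (Fin d) ℝ}
    {M S : Matrix (Fin d) (Fin d) ℝ} (hA : ∀ k, A k ∈ paramSpace d B) (hS : S.PosDef)
    (h : Tendsto A atTop (𝓝 M)) :
    ENNReal.ofReal (entropyLoss (limitEstimate B A) S) ≤
      liminf (fun k => ENNReal.ofReal (entropyLoss (A k) S)) atTop := by
  by_cases hdet : M.det = 0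
  -- At a singular limit the losses tend to infinity, so the default value costs nothing.
  · have hd : Tendsto (fun k => (A k).det) atTop (𝓝[>] 0) := by
      refine tendsto_nhdsWithin_iff.2 ⟨?_, .of_forall fun k => (hA k).1.det_pos⟩
      rw [← hdet]
      exact ((continuous_id.matrix_det).tendsto M).comp h
    have hlog := Real.tendsto_log_nhdsGT_zero.comp hd
    have hlower : Tendsto (fun k => Real.log S.det - Real.log (A k).det + d -
        2 * (d * Real.log 2)) atTop atTop := by
      have h1 := tendsto_atTop_add_const_left atTop
        (Real.log S.det + d - 2 * (d * Real.log 2)) (tendsto_neg_atBot_atTop.comp hlog)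
      refine h1.congr fun k => ?_
      simp only [Function.comp_apply]
      ring
    have htop : Tendsto (fun k => ENNReal.ofReal (entropyLoss (A k) S)) atTop (𝓝 ∞) :=
      ENNReal.tendsto_ofReal_atTop.comp (tendsto_atTop_mono
        (fun k => neg_log_det_le_entropyLoss (hA k).1 hS) hlower)
    rw [htop.liminf_eq]
    exact le_top
  · rw [limitEstimate_of_tendsto h hdet]
    have hM := mem_paramSpace_of_tendsto hB hA h hdet
    exact (ENNReal.tendsto_ofReal
      (tendsto_entropyLoss (fun k => (hA k).1) hM.1 hS h)).liminf_eq.ge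

/-- Fatou's lemma on top of the pointwise lower semicontinuity. -/
lemma risk_limitEstimator_le (hB : 0 < B) {δ : ℕ → Estimator n d B}
    (hconv : ∀ᵐ X ∂(sampleLaw n (1 : Matrix (Fin d) (Fin d) ℝ)),
      ∃ M, Tendsto (fun k => (δ k).est X) atTop (𝓝 M))
    {S : Matrix (Fin d) (Fin d) ℝ} (hS : S.PosDef) :
    (limitEstimator hB δ).risk S ≤ liminf (fun k => (δ k).risk S) atTop := by
  have h1 : (limitEstimator hB δ).risk S ≤
      ∫⁻ X, liminf (fun k => ENNReal.ofReal (entropyLoss ((δ k).est X) S)) atTop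
        ∂(sampleLaw n S) := by
    refine lintegral_mono_ae ?_
    filter_upwards [(sampleLaw_absolutelyContinuous hS).ae_le hconv] with X ⟨M, hM⟩
    exact entropyLoss_limitEstimate_le_liminf hB (fun k => (δ k).est_mem X) hS hM
  exact h1.trans (lintegral_liminf_le fun k =>
    ((measurable_entropyLoss S).comp (δ k).measurable).ennreal_ofReal)

/-- Every class of estimators with a given bound on the risk that is closed under harmonic means
contains near-minimizers of the mean trace that converge almost everywhere. -/
lemma exists_seq_tendsto (hB : 0 < B) {K : ℕ → Set (Estimator n d B)} (hK : Antitone K)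
    (hne : ∀ k, (K k).Nonempty)
    (hmid : ∀ k, ∀ δ ∈ K k, ∀ η ∈ K k, δ.harmonicMean hB η ∈ K k) :
    ∃ δ : ℕ → Estimator n d B, (∀ k, δ k ∈ K k) ∧
      ∀ᵐ X ∂(sampleLaw n (1 : Matrix (Fin d) (Fin d) ℝ)),
        ∃ M, Tendsto (fun k => (δ k).est X) atTop (𝓝 M) := by
  let v : ℕ → ℝ := fun k => sInf (Estimator.meanTrace '' K k)
  have hbdd : ∀ k, BddBelow (Estimator.meanTrace '' K k) := fun k =>
    ⟨0, by rintro _ ⟨δ, _, rfl⟩; exact (δ.meanTrace_mem_Icc hB).1⟩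
  have hvle : ∀ k, ∀ δ ∈ K k, v k ≤ δ.meanTrace := fun k δ hδ =>
    csInf_le (hbdd k) ⟨δ, hδ, rfl⟩
  -- The infima over shrinking classes increase and stay below `B d`, so they converge to some `w`.
  have hvmono : Monotone v := fun k l hkl =>
    csInf_le_csInf (hbdd k) ((hne l).image _) (Set.image_mono (hK hkl))
  have hvb : BddAbove (Set.range v) := ⟨B * d, by
    rintro _ ⟨k, rfl⟩
    obtain ⟨δ, hδ⟩ := hne k
    exact (hvle k δ hδ).trans (δ.meanTrace_mem_Icc hB).2⟩
  have hvlim := tendsto_atTop_ciSup hvmono hvb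
  set w := ⨆ k, v k with hw
  -- Chosen so that `8 B e N` is half of `(2⁻ᴺ)²`; the `L²` distances are then strictly below the
  -- summable `2⁻ᴺ`, which gives convergence almost everywhere without a subsequence.
  let e : ℕ → ℝ := fun N => ((1 / 2) ^ N) ^ 2 / (16 * B)
  have he : ∀ N, 0 < e N := fun N => by positivity
  have hexists : ∀ N, ∃ r, N ≤ r ∧ w - e N ≤ v r ∧ ∃ δ ∈ K r, δ.meanTrace ≤ w + e N := by
    intro N
    obtain ⟨m, hm⟩ := (hvlim.eventually (lt_mem_nhds (sub_lt_self w (he N)))).exists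
    refine ⟨max m N, le_max_right _ _, hm.le.trans (hvmono (le_max_left _ _)), ?_⟩
    obtain ⟨_, ⟨δ, hδ, rfl⟩, hlt⟩ := exists_lt_of_csInf_lt ((hne (max m N)).image _)
      (lt_add_of_pos_right (v (max m N)) (he N))
    refine ⟨δ, hδ, hlt.le.trans ?_⟩
    have := le_ciSup hvb (max m N)
    linarith
  choose r hNr hvr δ hδK hδle using hexists
  have hmin : ∀ k l N, N ≤ k → N ≤ l →
      w - e N ≤ ((δ k).harmonicMean hB (δ l)).meanTrace := by
    have heanti : ∀ k N, N ≤ k → e k ≤ e N := fun k N h => by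
      simp only [e]
      gcongr ?_ ^ 2 / _
      exact pow_le_pow_of_le_one (by norm_num) (by norm_num) h
    intro k l N hk hl
    -- The harmonic mean lies in the larger of the two nested classes, whose infimum is already at
    -- least `w - e N`.
    rcases le_total (r k) (r l) with h | h
    · have := hvle (r k) _ (hmid _ _ (hδK k) _ (hK h (hδK l)))
      linarith [hvr k, heanti k N hk]
    · have := hvle (r l) _ (hmid _ _ (hK h (hδK k)) _ (hδK l))
      linarith [hvr l, heanti l N hl]
  refine ⟨δ, fun k => hK (hNr k) (hδK k), ?_⟩
  have hentry : ∀ i j, ∀ᵐ X ∂(sampleLaw n (1 : Matrix (Fin d) (Fin d) ℝ)),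
      ∃ c : ℝ, Tendsto (fun k => (δ k).est X i j) atTop (𝓝 c) := by
    intro i j
    refine Lp.ae_tendsto_of_cauchy_eLpNorm (p := 2) (f := fun k X => (δ k).est X i j)
      (B := fun N => ENNReal.ofReal ((1 / 2) ^ N))
      (fun k => ((δ k).measurable_est i j).aestronglyMeasurable) (by norm_num) ?_ ?_
    · rw [← ENNReal.ofReal_tsum_of_nonneg (fun N => by positivity) summable_geometric_two]
      exact ENNReal.ofReal_ne_top
    · intro N k l hk hl
      have heanti : ∀ k N, N ≤ k → e k ≤ e N := fun k N h => by
        simp only [e]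
        gcongr ?_ ^ 2 / _
        exact pow_le_pow_of_le_one (by norm_num) (by norm_num) h
      have hpos : (0 : ℝ) < (1 / 2) ^ N := by positivity
      refine ((δ k).eLpNorm_sub_le hB (δ l) i j
        (c := Real.sqrt (8 * B * e N)) (Real.sqrt_nonneg _) ?_).trans_lt ?_
      · rw [Real.sq_sqrt (by have := he N; positivity)]
        have h1 := hδle k
        have h2 := hδle l
        have h3 := hmin k l N hk hl
        have h4 := heanti k N hk
        have h5 := heanti l N hl
        -- Each mean trace is at most `w + e N`, and that of the harmonic mean at least `w - e N`.
        have h6 : (δ k).meanTrace + (δ l).meanTrace -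
            2 * ((δ k).harmonicMean hB (δ l)).meanTrace ≤ 4 * e N := by linarith
        calc _ ≤ 2 * B * (4 * e N) := by gcongr
          _ = 8 * B * e N := by ring
      · refine (ENNReal.ofReal_lt_ofReal_iff hpos).2 ?_
        rw [Real.sqrt_lt' hpos]
        have : 8 * B * e N = ((1 / 2) ^ N) ^ 2 / 2 := by
          simp only [e]; field_simp; ring
        rw [this]
        exact half_lt_self (by positivity)
  have hall : ∀ᵐ X ∂(sampleLaw n (1 : Matrix (Fin d) (Fin d) ℝ)), ∀ i j,
      ∃ c : ℝ, Tendsto (fun k => (δ k).est X i j) atTop (𝓝 c) :=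
    ae_all_iff.2 fun i => ae_all_iff.2 fun j => hentry i j
  filter_upwards [hall] with X hX
  choose M hM using hX
  exact ⟨M, tendsto_matrix_iff.2 hM⟩

/-- If the minimax risk is finite, it is attained by an equivariant deterministic estimator. -/
lemma exists_equivariant_minimax (hB : 0 < B) (hfin : minimaxRisk n d B ≠ ∞) :
    ∃ δ : Estimator n d B, δ.IsEquivariant ∧
      ⨆ S ∈ paramSpace d B, δ.risk S ≤ minimaxRisk n d B := by
  let c : ℕ → ℝ≥0∞ := fun k => minimaxRisk n d B + ((k : ℝ≥0∞) + 1)⁻¹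
  have hc : Tendsto c atTop (𝓝 (minimaxRisk n d B)) := by
    have h1 : Tendsto (fun k : ℕ => ((k : ℝ≥0∞) + 1)⁻¹) atTop (𝓝 0) := by
      have := ENNReal.tendsto_inv_nat_nhds_zero.comp (tendsto_add_atTop_nat 1)
      refine this.congr fun k => ?_
      simp
    simpa using tendsto_const_nhds.add h1
  let K : ℕ → Set (Estimator n d B) := fun k =>
    {δ | δ.IsEquivariant ∧ ∀ S ∈ paramSpace d B, δ.risk S ≤ c k}
  have hK : Antitone K := fun k l hkl δ hδ => ⟨hδ.1, fun S hS => (hδ.2 S hS).trans (by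
    simp only [c]; gcongr)⟩
  have hne : ∀ k, (K k).Nonempty := by
    intro k
    -- Finiteness of the minimax risk is what makes this strict, hence the class nonempty.
    have hlt : minimaxRisk n d B < c k := ENNReal.lt_add_right hfin (by simp)
    obtain ⟨T, hT⟩ := iInf_lt_iff.1 hlt
    obtain ⟨δ, hδ, hle⟩ := exists_equivariant_risk_le hB T
    refine ⟨δ, hδ, fun S hS => ?_⟩
    exact (le_iSup₂ (f := fun S (_ : S ∈ paramSpace d B) => δ.risk S) S hS).trans
      (hle.trans hT.le)
  obtain ⟨δ, hδK, hconv⟩ := exists_seq_tendsto hB hK hne fun k δ hδ η hη =>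
    ⟨hδ.1.harmonicMean hB hη.1, fun S hS =>
      Estimator.risk_harmonicMean_le hB hS.1 (hδ.2 S hS) (hη.2 S hS)⟩
  refine ⟨limitEstimator hB δ, isEquivariant_limitEstimator hB fun k => (hδK k).1,
    iSup₂_le fun S hS => (risk_limitEstimator_le hB hconv hS.1).trans ?_⟩
  rw [← hc.liminf_eq]
  exact liminf_le_liminf (.of_forall fun k => (hδK k).2 S hS)

end Limit

/-! ### Power sums -/

section PowerSums

variable {d : ℕ}

/-- The first `d` power sums of a tuple. -/
def powerSums (D : Fin d → ℝ) : Fin d → ℝ := fun k => ∑ i, D i ^ ((k : ℕ) + 1)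

/-- Newton's identities express `k e_k` through lower elementary symmetric polynomials and the power
sums up to order `k`; over `ℝ` one divides by `k`. -/
lemma aeval_esymm_eq_of_powerSums_eq {x y : Fin d → ℝ} (h : powerSums x = powerSums y) :
    ∀ k ≤ d, MvPolynomial.aeval x (MvPolynomial.esymm (Fin d) ℝ k) =
      MvPolynomial.aeval y (MvPolynomial.esymm (Fin d) ℝ k) := by
  have hp : ∀ k, 0 < k → k ≤ d → MvPolynomial.aeval x (MvPolynomial.psum (Fin d) ℝ k) =
      MvPolynomial.aeval y (MvPolynomial.psum (Fin d) ℝ k) := by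
    intro k hk hkd
    have := congrFun h ⟨k - 1, by omega⟩
    simp only [powerSums, Nat.sub_add_cancel hk] at this
    simpa [MvPolynomial.psum] using this
  intro k
  induction k using Nat.strong_induction_on with
  | _ k ih =>
    intro hkd
    rcases Nat.eq_zero_or_pos k with rfl | hk
    · simp
    · have hx := congrArg (MvPolynomial.aeval x) (MvPolynomial.mul_esymm_eq_sum (Fin d) ℝ k)
      have hy := congrArg (MvPolynomial.aeval y) (MvPolynomial.mul_esymm_eq_sum (Fin d) ℝ k)
      simp only [map_mul, map_natCast, map_sum, map_pow, map_neg, map_one] at hx hy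
      have hk' : (k : ℝ) ≠ 0 := by exact_mod_cast hk.ne'
      refine mul_left_cancel₀ hk' ?_
      rw [hx, hy]
      congr 1
      refine Finset.sum_congr rfl fun a ha => ?_
      rw [Finset.mem_filter, Finset.HasAntidiagonal.mem_antidiagonal] at ha
      rw [ih a.1 ha.2 (by omega), hp a.2 (by omega) (by omega)]

/-- The elementary symmetric polynomials are the coefficients of `∏ (X - xᵢ)`, whose roots are the
multiset. -/
lemma map_eq_of_powerSums_eq {x y : Fin d → ℝ} (h : powerSums x = powerSums y) :
    (Finset.univ.val.map x : Multiset ℝ) = Finset.univ.val.map y := by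
  have he := aeval_esymm_eq_of_powerSums_eq h
  simp only [MvPolynomial.aeval_esymm_eq_multiset_esymm] at he
  have hprod : ((Finset.univ.val.map x).map fun t => Polynomial.X - Polynomial.C t).prod =
      ((Finset.univ.val.map y).map fun t => Polynomial.X - Polynomial.C t).prod := by
    rw [Multiset.prod_X_sub_X_eq_sum_esymm, Multiset.prod_X_sub_X_eq_sum_esymm]
    have hcard : ∀ z : Fin d → ℝ, (Finset.univ.val.map z).card = d := fun z => by simp
    rw [hcard, hcard]
    refine Finset.sum_congr rfl fun j hj => ?_
    rw [he j (by simpa [Nat.lt_succ_iff] using hj)]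
  have := congrArg Polynomial.roots hprod
  rwa [Polynomial.roots_multiset_prod_X_sub_C, Polynomial.roots_multiset_prod_X_sub_C] at this

lemma eq_of_powerSums_eq {x y : Fin d → ℝ} (hx : Antitone x) (hy : Antitone y)
    (h : powerSums x = powerSums y) : x = y := by
  have h1 := map_eq_of_powerSums_eq h
  rw [Fin.univ_val_map, Fin.univ_val_map, Multiset.coe_eq_coe] at h1
  have h2 : List.ofFn x = List.ofFn y :=
    h1.eq_of_pairwise' (List.sortedGE_ofFn_iff.2 hx).pairwise (List.sortedGE_ofFn_iff.2 hy).pairwise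
  exact List.ofFn_injective h2

lemma measurable_powerSums : Measurable (powerSums : (Fin d → ℝ) → Fin d → ℝ) := by
  unfold powerSums; fun_prop

/-- A measurable function of a decreasing tuple is a measurable function of its power sums. -/
lemma exists_measurable_of_powerSums {φ : (Fin d → ℝ) → Fin d → ℝ} (hφ : Measurable φ) :
    ∃ H : (Fin d → ℝ) → (Fin d → ℝ) × (Fin d → ℝ), Measurable H ∧
      ∀ D, Antitone D → H (powerSums D) = (D, φ D) := by
  have hclosed : IsClosed {D : Fin d → ℝ | Antitone D} := by
    simp only [Antitone, Set.ofPred_forall]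
    exact isClosed_iInter fun i => isClosed_iInter fun j => isClosed_iInter fun _ =>
      isClosed_le (continuous_apply j) (continuous_apply i)
  have := hclosed.measurableSet.standardBorel
  -- An injective measurable map out of a standard Borel space is a measurable embedding
  -- (Lusin–Souslin), so its inverse on the range extends measurably.
  have hemb : MeasurableEmbedding fun D : {D : Fin d → ℝ | Antitone D} => powerSums D.1 :=
    (measurable_powerSums.comp measurable_subtype_coe).measurableEmbedding fun D E h =>
      Subtype.ext (eq_of_powerSums_eq D.2 E.2 h)
  obtain ⟨H, hH, hHe⟩ := hemb.exists_measurable_extend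
    (g := fun D => (D.1, φ D.1)) (measurable_subtype_coe.prodMk (hφ.comp measurable_subtype_coe))
    fun _ => ⟨(0, 0)⟩
  exact ⟨H, hH, fun D hD => congrFun hHe ⟨D, hD⟩⟩

end PowerSums

/-! ### Equivariant estimators are spectral -/

section Spectral

variable {n d : ℕ} {B : ℝ}

lemma Estimator.IsEquivariant.est_eq {δ : Estimator n d B} (hδ : δ.IsEquivariant) (hn : 0 < n)
    {X Y : Sample n d} (h : empiricalCov X = empiricalCov Y) : δ.est X = δ.est Y := by
  obtain ⟨o, ho, rfl⟩ := exists_mixSample_eq hn h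
  exact (hδ.2 o ho X).symm

/-- A sample whose empirical covariance matrix is `Diag(D)`. -/
def canonicalSample (n : ℕ) (D : Fin d → ℝ) : Sample n d :=
  fun k => WithLp.toLp 2 fun i => if (i : ℕ) = k then Real.sqrt (n * D i) else 0

lemma measurable_canonicalSample : Measurable (canonicalSample n : (Fin d → ℝ) → Sample n d) := by
  refine measurable_pi_lambda _ fun k => (PiLp.continuous_toLp 2 _).measurable.comp ?_
  refine measurable_pi_lambda _ fun i => ?_
  split_ifs
  · fun_prop
  · exact measurable_const

/-- Observation `k` carries only coordinate `k`, so coordinates `i ≥ n` have none and their entries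
must vanish. -/
lemma empiricalCov_canonicalSample (hn : 0 < n) {D : Fin d → ℝ} (h0 : ∀ i, 0 ≤ D i)
    (hrank : ∀ i : Fin d, n ≤ i → D i = 0) :
    empiricalCov (canonicalSample n D) = Matrix.diagonal D := by
  have hn' : (n : ℝ) ≠ 0 := by exact_mod_cast hn.ne'
  ext i j
  rw [empiricalCov_apply]
  simp only [canonicalSample]
  rcases eq_or_ne i j with rfl | hij
  · rw [Matrix.diagonal_apply_eq]
    by_cases hi : (i : ℕ) < n
    · rw [Finset.sum_eq_single ⟨i, hi⟩]
      · have : 0 ≤ (n : ℝ) * D i := mul_nonneg (Nat.cast_nonneg _) (h0 i)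
        simp only [if_true]
        rw [Real.mul_self_sqrt this, inv_mul_cancel_left₀ hn']
      · intro k _ hk
        have : (i : ℕ) ≠ k := fun h => hk (Fin.ext h.symm)
        simp [this]
      · simp
    · rw [hrank i (not_lt.1 hi)]
      simp
  · rw [Matrix.diagonal_apply_ne _ hij, Finset.sum_eq_zero, mul_zero]
    intro k _
    by_cases hik : (i : ℕ) = k
    · have : (j : ℕ) ≠ k := fun h => hij (Fin.ext (hik.trans h.symm))
      simp [this]
    · simp [hik]

lemma rank_empiricalCov_le (X : Sample n d) : (empiricalCov X).rank ≤ n := by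
  let MX : Matrix (Fin d) (Fin n) ℝ := Matrix.of fun i k => X k i
  have h : empiricalCov X = ((n : ℝ)⁻¹ • MX) * MXᵀ := by
    ext i j
    simp [empiricalCov_apply, MX, Matrix.mul_apply, Finset.mul_sum, mul_assoc]
  rw [h]
  refine (Matrix.rank_mul_le_left _ _).trans ?_
  simpa using Matrix.rank_le_width ((n : ℝ)⁻¹ • MX)

lemma eigenvalue_nonneg {X : Sample n d} {U : Matrix (Fin d) (Fin d) ℝ}
    (hU : U ∈ Matrix.orthogonalGroup (Fin d) ℝ) {D : Fin d → ℝ}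
    (h : empiricalCov X = U * Matrix.diagonal D * Uᵀ) (i : Fin d) : 0 ≤ D i := by
  have h1 := posSemidef_conj (posSemidef_empiricalCov X) Uᵀ
  rw [h, Matrix.transpose_transpose] at h1
  have h2 : Uᵀ * (U * Matrix.diagonal D * Uᵀ) * U = Matrix.diagonal D :=
    transpose_mul_conj_mul hU _
  rw [h2] at h1
  simpa using h1.diag_nonneg (i := i)

/-- If `D i ≠ 0`, monotonicity makes the `i + 1` entries up to `i` nonzero, while the rank is at
most `n ≤ i`. -/
lemma eigenvalue_eq_zero {X : Sample n d} {U : Matrix (Fin d) (Fin d) ℝ}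
    (hU : U ∈ Matrix.orthogonalGroup (Fin d) ℝ) {D : Fin d → ℝ} (hD : Antitone D)
    (h : empiricalCov X = U * Matrix.diagonal D * Uᵀ) (i : Fin d) (hi : n ≤ i) : D i = 0 := by
  by_contra hne
  have hpos : ∀ j ≤ i, D j ≠ 0 := fun j hj =>
    (lt_of_lt_of_le (lt_of_le_of_ne (eigenvalue_nonneg hU h i) (Ne.symm hne)) (hD hj)).ne'
  have hUdet := (Matrix.isUnit_iff_isUnit_det U).1 (isUnit_of_mem_orthogonal hU)
  have hr := rank_empiricalCov_le X
  rw [h, Matrix.rank_mul_eq_left_of_isUnit_det _ _ (by rwa [Matrix.det_transpose]),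
    Matrix.rank_mul_eq_right_of_isUnit_det _ _ hUdet, Matrix.rank_diagonal] at hr
  have hcard : (Finset.Iic i).card ≤ Fintype.card {j // D j ≠ 0} := by
    rw [Fintype.card_subtype]
    exact Finset.card_le_card fun j hj => by simpa using hpos j (Finset.mem_Iic.1 hj)
  rw [Fin.card_Iic] at hcard
  omega

lemma submatrix_mem_orthogonal {U : Matrix (Fin d) (Fin d) ℝ}
    (hU : U ∈ Matrix.orthogonalGroup (Fin d) ℝ) (σ : Equiv.Perm (Fin d)) :
    U.submatrix id σ ∈ Matrix.orthogonalGroup (Fin d) ℝ := by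
  rw [Matrix.mem_orthogonalGroup_iff, Matrix.transpose_submatrix, Matrix.submatrix_mul_equiv,
    orthogonal_mul_transpose hU, Matrix.submatrix_id_id]

lemma submatrix_mul_diagonal_mul (U : Matrix (Fin d) (Fin d) ℝ) (σ : Equiv.Perm (Fin d))
    (E : Fin d → ℝ) :
    U.submatrix id σ * Matrix.diagonal (E ∘ σ) * (U.submatrix id σ)ᵀ =
      U * Matrix.diagonal E * Uᵀ := by
  rw [Matrix.transpose_submatrix, ← Matrix.submatrix_diagonal_equiv, Matrix.submatrix_mul_equiv,
    Matrix.submatrix_mul_equiv, Matrix.submatrix_id_id]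

/-- The diagonal of the estimate for a diagonal empirical covariance matrix. -/
def Estimator.diagonalEntries (δ : Estimator n d B) (D : Fin d → ℝ) : Fin d → ℝ :=
  fun i => δ.est (canonicalSample n D) i i

lemma Estimator.measurable_diagonalEntries (δ : Estimator n d B) :
    Measurable δ.diagonalEntries :=
  measurable_pi_lambda _ fun i => (δ.measurable_est i i).comp measurable_canonicalSample

lemma Estimator.IsEquivariant.est_of_antitone {δ : Estimator n d B} (hδ : δ.IsEquivariant)
    (hn : 0 < n) {X : Sample n d} {U : Matrix (Fin d) (Fin d) ℝ}
    (hU : U ∈ Matrix.orthogonalGroup (Fin d) ℝ) {D : Fin d → ℝ} (hD : Antitone D)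
    (h : empiricalCov X = U * Matrix.diagonal D * Uᵀ) :
    δ.est X = U * Matrix.diagonal (δ.diagonalEntries D) * Uᵀ := by
  have hcan : empiricalCov (canonicalSample n D) = Matrix.diagonal D :=
    empiricalCov_canonicalSample hn (eigenvalue_nonneg hU h) (eigenvalue_eq_zero hU hD h)
  have hdiag : δ.est (canonicalSample n D) = Matrix.diagonal (δ.diagonalEntries D) := by
    ext i j
    rcases eq_or_ne i j with rfl | hij
    · rw [Matrix.diagonal_apply_eq]; rfl
    · rw [Matrix.diagonal_apply_ne _ hij]
      -- Flipping coordinate `i` preserves the diagonal empirical covariance but changes the sign of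
      -- the `(i, j)` entry of the estimate, which is therefore zero.
      let s : Fin d → ℝ := Function.update 1 i (-1)
      have hs : ∀ k, s k * s k = 1 := fun k => by
        by_cases hk : k = i <;> simp [s, hk]
      have hg : Matrix.diagonal s ∈ Matrix.orthogonalGroup (Fin d) ℝ := by
        rw [Matrix.mem_orthogonalGroup_iff, Matrix.diagonal_transpose, Matrix.diagonal_mul_diagonal]
        simp [hs]
      have h1 : empiricalCov (actSample (Matrix.diagonal s) (canonicalSample n D)) =
          empiricalCov (canonicalSample n D) := by
        rw [empiricalCov_actSample, hcan, Matrix.diagonal_transpose, Matrix.diagonal_mul_diagonal,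
          Matrix.diagonal_mul_diagonal]
        congr 1
        funext k
        rw [mul_right_comm, hs, one_mul]
      have h2 := hδ.est_eq hn h1
      rw [hδ.1 _ hg, Matrix.diagonal_transpose] at h2
      have h3 := congrFun (congrFun h2 i) j
      rw [Matrix.mul_diagonal, Matrix.diagonal_mul] at h3
      simp only [s, Function.update_self, Function.update_of_ne hij.symm, Pi.one_apply] at h3
      linarith
  have h1 : empiricalCov X = empiricalCov (actSample U (canonicalSample n D)) := by
    rw [empiricalCov_actSample, hcan, h]
  rw [hδ.est_eq hn h1, hδ.1 U hU, hdiag]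

lemma exists_perm_antitone (D : Fin d → ℝ) : ∃ σ : Equiv.Perm (Fin d), Antitone (D ∘ σ) := by
  refine ⟨Tuple.sort (fun i => -D i), fun i j hij => ?_⟩
  have := Tuple.monotone_sort (fun i => -D i) hij
  simpa using this

lemma Estimator.IsEquivariant.est_eq_perm {δ : Estimator n d B} (hδ : δ.IsEquivariant)
    (hn : 0 < n) {X : Sample n d} {U : Matrix (Fin d) (Fin d) ℝ}
    (hU : U ∈ Matrix.orthogonalGroup (Fin d) ℝ) {D : Fin d → ℝ}
    (h : empiricalCov X = U * Matrix.diagonal D * Uᵀ) {σ : Equiv.Perm (Fin d)}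
    (hσ : Antitone (D ∘ σ)) :
    δ.est X = U * Matrix.diagonal (δ.diagonalEntries (D ∘ σ) ∘ σ.symm) * Uᵀ := by
  have h1 : empiricalCov X =
      U.submatrix id σ * Matrix.diagonal (D ∘ σ) * (U.submatrix id σ)ᵀ := by
    rw [submatrix_mul_diagonal_mul, h]
  have h2 := submatrix_mul_diagonal_mul U σ (δ.diagonalEntries (D ∘ σ) ∘ σ.symm)
  rw [Function.comp_assoc, Equiv.symm_comp_self, Function.comp_id] at h2
  rw [hδ.est_of_antitone hn (submatrix_mem_orthogonal hU σ) hσ h1, h2]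

/-- Equal eigenvalues receive equal estimates. -/
lemma Estimator.IsEquivariant.diagonalEntries_eq {δ : Estimator n d B} (hδ : δ.IsEquivariant)
    (hn : 0 < n) {X : Sample n d} {U : Matrix (Fin d) (Fin d) ℝ}
    (hU : U ∈ Matrix.orthogonalGroup (Fin d) ℝ) {D : Fin d → ℝ} (hD : Antitone D)
    (h : empiricalCov X = U * Matrix.diagonal D * Uᵀ) {i j : Fin d} (hij : D i = D j) :
    δ.diagonalEntries D i = δ.diagonalEntries D j := by
  -- Swapping equal eigenvalues leaves `D` unchanged, giving two expressions for the same estimate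
  -- in the same basis.
  have hswap : D ∘ Equiv.swap i j = D := by
    funext k
    simp only [Function.comp_apply, Equiv.swap_apply_def]
    split_ifs with h1 h2 <;> simp_all
  have h1 := hδ.est_eq_perm hn hU h (σ := Equiv.swap i j) (by rwa [hswap])
  rw [hδ.est_of_antitone hn hU hD h, hswap] at h1
  have h2 : ∀ E : Fin d → ℝ, Uᵀ * (U * Matrix.diagonal E * Uᵀ) * U = Matrix.diagonal E :=
    fun _ => transpose_mul_conj_mul hU _
  have h3 := congrArg (fun M => Uᵀ * M * U) h1
  simp only [h2] at h3
  have h4 := congrFun (Matrix.diagonal_injective h3) i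
  simpa using h4

/-- The value attached to `x` by a list of values attached to a list of points. -/
def lookup (D φ : Fin d → ℝ) (x : ℝ) : ℝ :=
  (∑ i, if D i = x then φ i else 0) / ∑ i, if D i = x then 1 else 0

/-- `lookup` averages over all matching indices; equal points carry equal values, so the average is
the common value. -/
lemma lookup_eq {D φ : Fin d → ℝ} (h : ∀ i j, D i = D j → φ i = φ j) (i : Fin d) :
    lookup D φ (D i) = φ i := by
  have hnum : (∑ j, if D j = D i then φ j else 0) = φ i * ∑ j, if D j = D i then 1 else 0 := by
    rw [Finset.mul_sum]
    refine Finset.sum_congr rfl fun j _ => ?_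
    split_ifs with hj
    · rw [h j i hj, mul_one]
    · rw [mul_zero]
  have hpos : (0 : ℝ) < ∑ j, if D j = D i then 1 else 0 :=
    Finset.sum_pos' (fun j _ => by positivity) ⟨i, Finset.mem_univ i, by simp⟩
  rw [lookup, hnum, mul_div_cancel_right₀ _ hpos.ne']

lemma measurable_lookup :
    Measurable fun q : (Fin d → ℝ) × (Fin d → ℝ) × ℝ => lookup q.1 q.2.1 q.2.2 := by
  have hset : ∀ i, MeasurableSet {q : (Fin d → ℝ) × (Fin d → ℝ) × ℝ | q.1 i = q.2.2} := fun i =>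
    measurableSet_eq_fun (by fun_prop) (by fun_prop)
  unfold lookup
  refine Measurable.div ?_ ?_
  · exact Finset.measurable_sum _ fun i _ => Measurable.ite (hset i) (by fun_prop) measurable_const
  · exact Finset.measurable_sum _ fun i _ => Measurable.ite (hset i) measurable_const measurable_const

/-- Every equivariant estimator is of the form `Σ̂_{f,g}`. -/
lemma Estimator.IsEquivariant.mem_spectralEstimators {δ : Estimator n d B}
    (hδ : δ.IsEquivariant) (hn : 0 < n) : δ ∈ spectralEstimators n d B := by
  obtain ⟨H, hH, hHe⟩ := exists_measurable_of_powerSums δ.measurable_diagonalEntries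
  -- Restores the term missing from a sum over `j ≠ i`, giving the full power sums. The exponents `k
  -- + 1` run from `1` to `d`.
  let q : ℝ × (Fin d → ℝ) → Fin d → ℝ := fun p k => p.2 k + p.1 ^ ((k : ℕ) + 1)
  have hq : Measurable q := measurable_pi_lambda _ fun k => by fun_prop
  refine ⟨fun x p => lookup (H (q (x, p))).1 (H (q (x, p))).2 x,
    fun _ y k => y ^ ((k : ℕ) + 1), ?_, ?_, ?_⟩
  · have h1 : Measurable fun p : ℝ × (Fin d → ℝ) => ((H (q p)).1, (H (q p)).2, p.1) :=
      (measurable_fst.comp (hH.comp hq)).prodMk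
        ((measurable_snd.comp (hH.comp hq)).prodMk measurable_fst)
    exact measurable_lookup.comp h1
  · exact measurable_pi_lambda _ fun k => by
      simp only [Function.uncurry]; fun_prop
  · intro X U hU D h
    obtain ⟨σ, hσ⟩ := exists_perm_antitone D
    rw [hδ.est_eq_perm hn hU h hσ]
    congr 3
    funext i
    have hqi : q (D i, ∑ j ∈ Finset.univ.erase i, fun k : Fin d => D j ^ ((k : ℕ) + 1)) =
        powerSums (D ∘ σ) := by
      funext k
      simp only [q, powerSums, Finset.sum_apply, Function.comp_apply]
      rw [Equiv.sum_comp σ fun j => D j ^ ((k : ℕ) + 1)]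
      exact Finset.sum_erase_add _ _ (Finset.mem_univ i)
    simp only [spectralEntry]
    rw [hqi, hHe _ hσ]
    have hsorted : empiricalCov X =
        U.submatrix id σ * Matrix.diagonal (D ∘ σ) * (U.submatrix id σ)ᵀ := by
      rw [submatrix_mul_diagonal_mul, h]
    have hlook := lookup_eq (D := D ∘ σ) (φ := δ.diagonalEntries (D ∘ σ))
      (fun i j hij => hδ.diagonalEntries_eq hn (submatrix_mem_orthogonal hU σ) hσ hsorted hij)
      (σ.symm i)
    simp only [Function.comp_apply, Equiv.apply_symm_apply] at hlook ⊢
    exact hlook.symm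

end Spectral

/-! ### The reduced game -/

section ReducedGame

variable {n d : ℕ} {B : ℝ}

lemma exists_eigendecomposition {A : Matrix (Fin d) (Fin d) ℝ} (hA : A.IsHermitian) :
    ∃ U ∈ Matrix.orthogonalGroup (Fin d) ℝ, ∃ D : Fin d → ℝ, Antitone D ∧
      A = U * Matrix.diagonal D * Uᵀ := by
  obtain ⟨σ, hσ⟩ := exists_perm_antitone hA.eigenvalues
  have hU : (hA.eigenvectorUnitary : Matrix (Fin d) (Fin d) ℝ) ∈
    Matrix.orthogonalGroup (Fin d) ℝ := hA.eigenvectorUnitary.2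
  refine ⟨_, submatrix_mem_orthogonal hU σ, _, hσ, ?_⟩
  rw [submatrix_mul_diagonal_mul]
  conv_lhs => rw [hA.spectral_theorem, Unitary.conjStarAlgAut_apply]
  rw [← Matrix.conjTranspose_eq_transpose_of_trivial]
  rfl

/-- If `U` diagonalizes the empirical covariance of `X`, then `V U` diagonalizes that of the rotated
data with the same eigenvalues. -/
lemma spectralEstimators_subset :
    spectralEstimators n d B ⊆ invariantEstimators n d B := by
  rintro δ ⟨f, g, _, _, hδ⟩ V hV X
  obtain ⟨U, hU, D, _, hX⟩ := exists_eigendecomposition (posSemidef_empiricalCov X).isHermitian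
  have hVX : empiricalCov (actSample V X) = (V * U) * Matrix.diagonal D * (V * U)ᵀ := by
    rw [empiricalCov_actSample, hX, Matrix.transpose_mul]
    simp only [Matrix.mul_assoc]
  rw [hδ X U hU D hX, hδ _ (V * U) (mul_mem hV hU) D hVX, Matrix.transpose_mul]
  simp only [Matrix.mul_assoc]

lemma risk_conj_of_invariant {δ : Estimator n d B} (hδ : δ ∈ invariantEstimators n d B)
    {g : Matrix (Fin d) (Fin d) ℝ} (hg : g ∈ Matrix.orthogonalGroup (Fin d) ℝ)
    {S : Matrix (Fin d) (Fin d) ℝ} (hS : S.PosSemidef) : δ.risk (g * S * gᵀ) = δ.risk S := by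
  have hm : Measurable fun Y : Sample n d =>
      ENNReal.ofReal (entropyLoss (δ.est Y) (g * S * gᵀ)) :=
    ((measurable_entropyLoss _).comp δ.measurable).ennreal_ofReal
  rw [Estimator.risk, ← map_actSample_sampleLaw hS g, lintegral_map hm (measurable_actSample g)]
  refine lintegral_congr fun X => ?_
  rw [hδ g hg X, entropyLoss_conj hg]

lemma diagonal_mem_paramSpace (hB : 0 < B) {l : Fin d → ℝ} (hl : l ∈ spectrumSpace d B) :
    Matrix.diagonal l ∈ paramSpace d B := by
  rw [mem_paramSpace_iff hB.le]
  refine ⟨Matrix.PosDef.diagonal fun i => (hl.2 i).1, ?_⟩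
  rw [← Matrix.diagonal_one, ← Matrix.diagonal_smul, Matrix.diagonal_sub]
  exact Matrix.posSemidef_diagonal_iff.2 fun i => by simpa using (hl.2 i).2

lemma exists_spectrum {S : Matrix (Fin d) (Fin d) ℝ} (hB : 0 < B) (hS : S ∈ paramSpace d B) :
    ∃ U ∈ Matrix.orthogonalGroup (Fin d) ℝ, ∃ l ∈ spectrumSpace d B,
      S = U * Matrix.diagonal l * Uᵀ := by
  obtain ⟨U, hU, D, hD, h⟩ := exists_eigendecomposition hS.1.isHermitian
  refine ⟨U, hU, D, ⟨hD, fun i => ?_⟩, h⟩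
  have h1 := conj_mem_paramSpace hB.le hS (transpose_mem_orthogonal hU)
  have h2 : Uᵀ * S * Uᵀᵀ = Matrix.diagonal D := by
    rw [h, Matrix.transpose_transpose, transpose_mul_conj_mul hU]
  rw [h2, mem_paramSpace_iff hB.le, ← Matrix.diagonal_one, ← Matrix.diagonal_smul,
    Matrix.diagonal_sub, Matrix.posDef_diagonal_iff, Matrix.posSemidef_diagonal_iff] at h1
  exact ⟨h1.1 i, by simpa using h1.2 i⟩

/-- A randomized estimator supported on a class, regarded as supported on a larger class. -/
def RandomizedEstimator.ofSubset {C C' : Set (Estimator n d B)} (h : C ⊆ C')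
    (T : RandomizedEstimator C) : RandomizedEstimator C' where
  Seed := T.Seed
  law := T.law
  draw := T.draw
  draw_mem ω := h (T.draw_mem ω)
  measurable_draw := T.measurable_draw

/-- A deterministic estimator, regarded as a randomized estimator. -/
def Estimator.toRandomized {C : Set (Estimator n d B)} (δ : Estimator n d B) (h : δ ∈ C) :
    RandomizedEstimator C where
  Seed := Unit
  law := Measure.dirac ()
  draw _ := δ
  draw_mem _ := h
  measurable_draw i j := (δ.measurable_est i j).comp measurable_snd

lemma Estimator.risk_toRandomized {C : Set (Estimator n d B)} (δ : Estimator n d B) (h : δ ∈ C)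
    (S : Matrix (Fin d) (Fin d) ℝ) : (δ.toRandomized h).risk S = δ.risk S :=
  lintegral_dirac (a := ()) (f := fun _ => δ.risk S)

lemma reducedValue_antitone {C C' : Set (Estimator n d B)} (h : C ⊆ C') :
    reducedValue C' ≤ reducedValue C :=
  le_iInf fun T => iInf_le_of_le (T.ofSubset h) le_rfl

/-- For invariant draws the risk is constant on orthogonal conjugacy classes, each of which meets
`spectrumSpace`; restricting nature to diagonal matrices loses nothing. -/
lemma minimaxRisk_le_reducedValue (hB : 0 < B) :
    minimaxRisk n d B ≤ reducedValue (invariantEstimators n d B) := by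
  refine le_iInf fun T => iInf_le_of_le (T.ofSubset (Set.subset_univ _)) (iSup₂_le fun S hS => ?_)
  obtain ⟨U, hU, l, hl, rfl⟩ := exists_spectrum hB hS
  have h : (T.ofSubset (Set.subset_univ _)).risk (U * Matrix.diagonal l * Uᵀ) =
      T.risk (Matrix.diagonal l) :=
    lintegral_congr fun ω => risk_conj_of_invariant (T.draw_mem ω) hU
      (diagonal_mem_paramSpace hB hl).1.posSemidef
  rw [h]
  exact le_iSup₂ (f := fun l (_ : l ∈ spectrumSpace d B) => T.risk (Matrix.diagonal l)) l hl

lemma minimaxRisk_le_iSup_risk (δ : Estimator n d B) :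
    minimaxRisk n d B ≤ ⨆ S ∈ paramSpace d B, δ.risk S := by
  refine iInf_le_of_le (δ.toRandomized (Set.mem_univ δ)) ?_
  simp only [Estimator.risk_toRandomized, le_refl]

lemma reducedValue_le_iSup_risk (hB : 0 < B) {C : Set (Estimator n d B)} {δ : Estimator n d B}
    (h : δ ∈ C) : reducedValue C ≤ ⨆ S ∈ paramSpace d B, δ.risk S := by
  refine iInf_le_of_le (δ.toRandomized h) (iSup₂_le fun l hl => ?_)
  rw [Estimator.risk_toRandomized]
  exact le_iSup₂ (f := fun S (_ : S ∈ paramSpace d B) => δ.risk S) _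
    (diagonal_mem_paramSpace hB hl)

/-- The estimator that always answers `B • 1`. -/
def constantEstimator (n d : ℕ) (hB : 0 < B) : Estimator n d B where
  est _ := B • 1
  measurable_est _ _ := measurable_const
  est_mem _ := smul_one_mem_paramSpace hB

lemma constantEstimator_isEquivariant (hB : 0 < B) :
    (constantEstimator n d hB).IsEquivariant := by
  refine ⟨fun g hg X => ?_, fun _ _ _ => rfl⟩
  simp [constantEstimator, orthogonal_mul_transpose hg]

/-- The minimax risk is attained by a deterministic estimator of the form `Σ̂_{f,g}`. -/
lemma exists_spectral_minimax (hn : 0 < n) (hB : 0 < B) :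
    ∃ δ ∈ spectralEstimators n d B, δ.IsMinimax := by
  obtain ⟨δ, hδ, hle⟩ : ∃ δ : Estimator n d B, δ.IsEquivariant ∧
      ⨆ S ∈ paramSpace d B, δ.risk S ≤ minimaxRisk n d B := by
    -- If the value is infinite, every estimator is minimax and a constant equivariant one will do.
    by_cases hfin : minimaxRisk n d B = ∞
    · exact ⟨constantEstimator n d hB, constantEstimator_isEquivariant hB, hfin ▸ le_top⟩
    · exact exists_equivariant_minimax hB hfin
  exact ⟨δ, hδ.mem_spectralEstimators hn, le_antisymm hle (minimaxRisk_le_iSup_risk δ)⟩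

end ReducedGame

end CovarianceGame

end

/-! ### The theorem. -/

theorem proposition4 (n d : ℕ) (hn : 0 < n) (hd : 0 < d) (B : ℝ) (hB : 0 < B) :
    (∃ δ : CovarianceGame.Estimator n d B, δ.IsMinimax ∧
      ∀ ε : ℝ, 0 < ε →
        ∃ η ∈ CovarianceGame.spectralEstimators n d B,
          (∀ X, CovarianceGame.opNorm (η.est X - δ.est X) ≤ ε) ∧
          ∀ S ∈ CovarianceGame.paramSpace d B,
            η.risk S ≤ δ.risk S + ENNReal.ofReal ε ∧ δ.risk S ≤ η.risk S + ENNReal.ofReal ε) ∧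
    CovarianceGame.reducedValue (CovarianceGame.invariantEstimators n d B) =
      CovarianceGame.reducedValue (CovarianceGame.spectralEstimators n d B) ∧
    CovarianceGame.reducedValue (CovarianceGame.spectralEstimators n d B) =
      CovarianceGame.minimaxRisk n d B := by
  obtain ⟨δ, hδ, hmin⟩ := CovarianceGame.exists_spectral_minimax (d := d) hn hB
  have h1 := CovarianceGame.reducedValue_antitone
    (CovarianceGame.spectralEstimators_subset (n := n) (d := d) (B := B))
  have h2 := CovarianceGame.minimaxRisk_le_reducedValue (n := n) (d := d) hB
  have h3 := (CovarianceGame.reducedValue_le_iSup_risk hB hδ).trans hmin.le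
  -- The minimax estimator is spectral, so it serves as its own approximation for every `ε`. The two
  -- reduced values and `R*` are equal by a cycle of three inequalities.
  refine ⟨⟨δ, hmin, fun ε hε => ⟨δ, hδ, fun X => ?_, fun S _ => ⟨le_self_add, le_self_add⟩⟩⟩,
    le_antisymm h1 (h3.trans h2), le_antisymm h3 (h2.trans h1)⟩
  simp [CovarianceGame.opNorm, hε.le]
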